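/- Let $d\ge 1$, let $I_\pm=\{\pm1,\dots,\pm d\}$ with $r(\tau)=\mathrm{sign}(\tau)\,e_{|\tau|}\in\mathbb Z^d$ for $\tau\in I_\pm$, and let $\mathcal H=\mathbb C^{2d}\otimes \ell^2(\mathbb Z^d)$ with standard orthonormal basis $|\tau,x\rangle$, $\tau\in I_\pm$, $x\in\mathbb Z^d$. Write $|x|=\max_i|x_i|$ on $\mathbb Z^d$. Let $\mu$ be a probability measure on $\mathbb T=\mathbb R/2\pi\mathbb Z$ with a bounded density, $d\mu(\theta)=l(\theta)\,d\theta$, $0\le l\in L^\infty(\mathbb T)$, and let $\omega=(\omega^\tau_x)_{x\in\mathbb Z^d,\tau\in I_\pm}$ be i.i.d. with law $\mu$. For a unitary matrix $C\in U(2d)$ let $$U_\omega(C)=\mathbb D(\omega)\,S\,(C\otimes\mathbb I),\qquad S|\tau,x\rangle=|\tau,x+r(\tau)\rangle,\qquad \mathbb D(\omega)|\tau,x\rangle=e^{i\omega^\tau_x}|\tau,x\rangle .$$ Let $\pi$ be a permutation of $I_\pm$ such that for every cycle $(\tau,\pi(\tau),\dots,\pi^{m-1}(\tau))$ of $\pi$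 (a fixed point counting as a cycle with $m=1$) one has $\sum_{k=0}^{m-1}r(\pi^k(\tau))=0$, and let $C_\pi\in U(2d)$ be the permutation matrix $C_\pi|\tau\rangle=|\pi(\tau)\rangle$. Theorem. There is $\delta>0$ such that for every $0<s<1/3$ there are finite constants $\gamma>0$ and $c>0$ with the following property: for all $C\in U(2d)$ with $\|C-C_\pi\|\le\delta$ (operator norm on $\mathbb C^{2d}$), all $x,y\in\mathbb Z^d$ with $|x-y|>2$, all $\tau,\sigma\in I_\pm$ and all $z\in\mathbb C$ with $|z|\in(1/2,2)\setminus\{1\}$, $$\mathbb E_\omega\big(\,|\langle\tau,x|(U_\omega(C)-z)^{-1}|\sigma,y\rangle|^s\,\big)\le c\,e^{-\gamma|x-y|}.$$ Here $\delta$ depends only on $d,\mu,\pi$, while $\gamma$ and $c$ may also depend on $s$. (Under these conditions $U_\omega(C)-z$ is boundedly invertible for every $\omega$ and the expectation is that of an integrable random variable.) -/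

import Mathlib

open MeasureTheory

/-- The period `2π` is positive; Mathlib needs this as an instance to equip
`ℝ / 2πℤ` with Lebesgue measure. -/
instance twoPiPosFact : Fact (0 < 2 * Real.pi) := ⟨Real.two_pi_pos⟩

namespace QWalk

/-- The torus `𝕋 = ℝ / 2πℤ`. Its `volume` is the Lebesgue measure `dθ`, of total mass `2π`. -/
abbrev Torus : Type := AddCircle (2 * Real.pi)

/-- The lattice `ℤᵈ`. Its norm `‖x‖` in Mathlib is the maximum norm `max_i |x_i|`. -/
abbrev Site (d : ℕ) : Type := Fin d → ℤ

/-- The coin index set `I_± = {±1, …, ±d}`: the index `±j` is the pair `(j, ±1)`. -/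
abbrev Coin (d : ℕ) : Type := Fin d × ℤˣ

/-- The jump `r(τ) = sign(τ) e_{|τ|}`. -/
def jump {d : ℕ} (τ : Coin d) : Site d := Pi.single τ.1 (τ.2 : ℤ)

/-- Labels `(τ, x)` of the standard basis vectors `|τ, x⟩`. -/
abbrev Label (d : ℕ) : Type := Coin d × Site d

/-- The Hilbert space `ℂ^{2d} ⊗ ℓ²(ℤᵈ)`, realised as `ℓ²(I_± × ℤᵈ)`. -/
abbrev Hil (d : ℕ) : Type := lp (fun _ : Label d => ℂ) 2

/-- The standard basis vector `|τ, x⟩`. -/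
noncomputable def ket {d : ℕ} (τ : Coin d) (x : Site d) : Hil d := lp.single 2 (τ, x) 1

/-! ### Weighted substitution operators -/

theorem sum_weighted_le {d : ℕ} (f : Label d → Label d) (hf : Function.Injective f)
    (w : Label d → ℂ) (hw : ∀ i, ‖w i‖ ≤ 1) (ψ : Hil d) (s : Finset (Label d)) :
    ∑ i ∈ s, ‖w i * ψ (f i)‖ ^ (2 : ENNReal).toReal ≤ ‖ψ‖ ^ (2 : ENNReal).toReal := by
  classical
  calc ∑ i ∈ s, ‖w i * ψ (f i)‖ ^ (2 : ENNReal).toReal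
      ≤ ∑ i ∈ s, ‖ψ (f i)‖ ^ (2 : ENNReal).toReal := by
        refine Finset.sum_le_sum fun i _ => ?_
        refine Real.rpow_le_rpow (norm_nonneg _) ?_ (by norm_num)
        rw [norm_mul]
        exact mul_le_of_le_one_left (norm_nonneg _) (hw i)
    _ = ∑ j ∈ s.image f, ‖ψ j‖ ^ (2 : ENNReal).toReal := by
        rw [Finset.sum_image (fun a _ b _ h => hf h)]
    _ ≤ ‖ψ‖ ^ (2 : ENNReal).toReal := lp.sum_rpow_le_norm_rpow (by norm_num) ψ _

/-- The bounded operator `(W ψ)(i) = w(i) ψ(f(i))` on `ℓ²`, for `f` injective and `|w| ≤ 1`. -/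
noncomputable def wcomp {d : ℕ} (f : Label d → Label d) (hf : Function.Injective f)
    (w : Label d → ℂ) (hw : ∀ i, ‖w i‖ ≤ 1) : Hil d →L[ℂ] Hil d :=
  LinearMap.mkContinuous
    { toFun := fun ψ => ⟨fun i => w i * ψ (f i), memℓp_gen' (sum_weighted_le f hf w hw ψ)⟩
      map_add' := fun ψ φ => by
        ext i
        exact mul_add _ _ _
      map_smul' := fun a ψ => by
        ext i
        exact mul_left_comm _ _ _ }
    1 (fun ψ => by
      rw [one_mul]
      exact lp.norm_le_of_forall_sum_le (by norm_num) (norm_nonneg _)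
        (sum_weighted_le f hf w hw ψ))

theorem wcomp_apply {d : ℕ} (f : Label d → Label d) (hf : Function.Injective f)
    (w : Label d → ℂ) (hw : ∀ i, ‖w i‖ ≤ 1) (ψ : Hil d) (i : Label d) :
    wcomp f hf w hw ψ i = w i * ψ (f i) := rfl

/-! ### The random quantum walk -/

/-- The coin state dependent shift `S`, `S |τ, x⟩ = |τ, x + r(τ)⟩`,
i.e. `(S ψ)(τ, x) = ψ(τ, x - r(τ))`. -/
noncomputable def shiftOp (d : ℕ) : Hil d →L[ℂ] Hil d :=
  wcomp (fun i => (i.1, i.2 - jump i.1))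
    (fun a b h => by
      obtain ⟨h1, h2⟩ := Prod.mk.inj h
      rw [h1] at h2
      exact Prod.ext h1 (sub_left_injective h2))
    (fun _ => 1) (fun _ => by simp)

/-- The operator `|τ⟩⟨σ| ⊗ 𝕀`. -/
noncomputable def coinUnit {d : ℕ} (τ σ : Coin d) : Hil d →L[ℂ] Hil d :=
  wcomp (fun i => (Equiv.swap τ σ i.1, i.2))
    (fun a b h => by
      obtain ⟨h1, h2⟩ := Prod.mk.inj h
      exact Prod.ext ((Equiv.swap τ σ).injective h1) h2)
    (fun i => if i.1 = τ then 1 else 0) (fun i => by split_ifs <;> simp)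

/-- The operator `C ⊗ 𝕀 = ∑_{τ,σ} C_{τ,σ} |τ⟩⟨σ| ⊗ 𝕀`. -/
noncomputable def coinOp {d : ℕ} (C : Matrix (Coin d) (Coin d) ℂ) : Hil d →L[ℂ] Hil d :=
  ∑ τ, ∑ σ, C τ σ • coinUnit τ σ

theorem coinUnit_apply {d : ℕ} (τ σ κ : Coin d) (ψ : Hil d) (x : Site d) :
    coinUnit τ σ ψ (κ, x) = if κ = τ then ψ (σ, x) else 0 := by
  change (if κ = τ then (1 : ℂ) else 0) * ψ (Equiv.swap τ σ κ, x) = _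
  by_cases h : κ = τ
  · subst h
    simp
  · simp [h]

theorem coinOp_apply {d : ℕ} (C : Matrix (Coin d) (Coin d) ℂ) (ψ : Hil d) (τ : Coin d)
    (x : Site d) : coinOp C ψ (τ, x) = ∑ σ, C τ σ * ψ (σ, x) := by
  have h : lp.evalₗ (fun _ : Label d => ℂ) 2 (𝕜 := ℂ) (τ, x) (coinOp C ψ)
      = ∑ κ, ∑ σ, C κ σ * (if τ = κ then ψ (σ, x) else 0) := by
    simp only [coinOp, _root_.sum_apply, _root_.smul_apply, map_sum,
      map_smul, smul_eq_mul]
    refine Finset.sum_congr rfl fun κ _ => Finset.sum_congr rfl fun σ _ => ?_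
    congr 1
    exact coinUnit_apply κ σ τ ψ x
  refine h.trans ?_
  rw [Finset.sum_eq_single τ] <;> simp +contextual [eq_comm]

/-- A realisation `ω` of the phases `ω_x^τ ∈ 𝕋`. -/
abbrev Phases (d : ℕ) : Type := Label d → Torus

/-- The law of the i.i.d. phases: the infinite product of copies of `μ`. -/
noncomputable def phaseLaw (d : ℕ) (μ : Measure Torus) [IsProbabilityMeasure μ] :
    Measure (Phases d) :=
  Measure.infinitePi (fun _ : Label d => μ)

/-- The diagonal random operator `𝔻(ω) |τ, x⟩ = e^{i ω_x^τ} |τ, x⟩`. -/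
noncomputable def phaseOp {d : ℕ} (ω : Phases d) : Hil d →L[ℂ] Hil d :=
  wcomp id Function.injective_id (fun i => (AddCircle.toCircle (ω i) : ℂ))
    (fun _ => Circle.norm_coe _ |>.le)

/-- The one-step evolution `U_ω(C) = 𝔻(ω) S (C ⊗ 𝕀)`. -/
noncomputable def walk {d : ℕ} (ω : Phases d) (C : Matrix (Coin d) (Coin d) ℂ) :
    Hil d →L[ℂ] Hil d :=
  phaseOp ω ∘L shiftOp d ∘L coinOp C

/-- The resolvent `(U_ω(C) - z)⁻¹` (and `0` when `U_ω(C) - z` is not invertible). -/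
noncomputable def res {d : ℕ} (ω : Phases d) (C : Matrix (Coin d) (Coin d) ℂ) (z : ℂ) :
    Hil d →L[ℂ] Hil d :=
  Ring.inverse (walk ω C - z • ContinuousLinearMap.id ℂ (Hil d))

/-! ### Hypotheses -/

/-- `μ` has a bounded density: `dμ(θ) = l(θ) dθ` with `0 ≤ l ∈ L^∞(𝕋)`. -/
def HasBoundedDensity (μ : Measure Torus) : Prop :=
  ∃ l : Torus → ℝ, MemLp l ⊤ volume ∧ (∀ θ, 0 ≤ l θ) ∧
    μ = volume.withDensity (fun θ => ENNReal.ofReal (l θ))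

/-- The permutation matrix `C_π |τ⟩ = |π(τ)⟩`. -/
def permCoin {d : ℕ} (π : Equiv.Perm (Coin d)) : Matrix (Coin d) (Coin d) ℂ :=
  Matrix.of fun σ τ => if σ = π τ then 1 else 0

/-- Along every cycle `(τ, π(τ), …, π^{m-1}(τ))` of `π`, with `m` the period of `τ`, the jumps
add up to zero. (A fixed point is a cycle of length one, so it is excluded.) -/
def JumpsCancel {d : ℕ} (π : Equiv.Perm (Coin d)) : Prop :=
  ∀ τ : Coin d, ∑ s ∈ Finset.range (Function.minimalPeriod π τ), jump ((π ^ s) τ) = 0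

/-- The operator norm of a matrix acting on the Hilbert space `ℂ^{2d}`. -/
noncomputable def coinNorm {d : ℕ} (A : Matrix (Coin d) (Coin d) ℂ) : ℝ :=
  ‖Matrix.toEuclideanCLM (𝕜 := ℂ) A‖

end QWalk

open QWalk

namespace QWalk

/-! The proof is a fractional moment argument. With `V = S (C ⊗ 𝕀)` one has `U - z = 𝔻 (V - z 𝔻⁻¹)`,
so for `|z| < 1` the matrix elements of the resolvent have the same modulus as those of `(V - z
W)⁻¹`, where `W` is diagonal with weights `e^{-iω}`. The case `|z| > 1` reduces to this one through
the reflection `z ↦ 1 / z̄` (`res_eq_reflection`).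

Letting weights range over the closed disc allows a single one to be set to zero. A rank one
perturbation then shows that `G(i,j)`, as a function of the phase `θ` at `i` or at `j`, is `a / (1 -
p e^{-iθ})` with `|p| < 1` (`green_update_mul`, `norm_green_le_one`). Since the density is bounded
and `s < 1`, this gives an a priori bound on `E|G|^s` uniform in `z` (`lintegral_green_rpow_le`),
and a decoupling estimate that removes a factor `|1 - q e^{-iθ}|^s` at the cost of a constant
(`exists_lintegral_rpow_neg_le_mul`).

For `C = C_π` the walk carries basis vectors around closed loops, because the jumps cancel. For `C`
near `C_π`, following a loop back to its start gives `(1 - q w_i) G(i,j) = O(‖C - C_π‖)`, where the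
error is a sum of Green functions from labels on the loop's sites and `q` does not involve the phase
at `i`. Decoupling turns this into `E|G(i,j)|^s ≤ const · δ^s · ∑ E|G(i',j)|^s` over boundedly many
nearby `i'` (`lintegral_green_rpow_le_sum`). For small `δ` each use gains a factor `1/2`, and the
number of uses before `j` is reached is proportional to the distance.

The smallness of `δ` depends on the exponent, so the argument is run at the exponent `1/3` only;
smaller exponents follow by monotonicity of `L^p` norms on a probability space. -/

/-! ### Resampling one coordinate of an infinite product measure -/

/-- Replacing one i.i.d. coordinate by an independent copy does not change the law; it suffices to
check boxes. This allows one phase to be averaged with the others frozen, without splitting the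
product space. -/
theorem measurePreserving_update {ι : Type*} [DecidableEq ι] {X : Type*} [MeasurableSpace X]
    (μ : Measure X) [IsProbabilityMeasure μ] (i : ι) :
    MeasurePreserving (fun p : (ι → X) × X => Function.update p.1 i p.2)
      ((Measure.infinitePi fun _ : ι => μ).prod μ) (Measure.infinitePi fun _ : ι => μ) := by
  have hm : Measurable (fun p : (ι → X) × X => Function.update p.1 i p.2) := by
    refine measurable_pi_lambda _ fun k => ?_
    by_cases h : k = i
    · subst h; simpa using measurable_snd
    · simp only [Function.update_of_ne h]
      exact (measurable_pi_apply k).comp measurable_fst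
  refine ⟨hm, Measure.eq_infinitePi _ fun s t ht => ?_⟩
  rw [Measure.map_apply hm (MeasurableSet.pi s.countable_toSet fun k _ => ht k)]
  have hset : (fun p : (ι → X) × X => Function.update p.1 i p.2) ⁻¹' Set.pi (s : Set ι) t
      = Set.pi ((s.erase i : Finset ι) : Set ι) t ×ˢ (if i ∈ s then t i else Set.univ) := by
    ext ⟨ω, θ⟩
    simp only [Set.mem_preimage, Set.mem_pi, SetLike.mem_coe, Finset.coe_erase, Set.mem_prod]
    constructor
    · intro h
      refine ⟨fun k hk => ?_, ?_⟩
      · have := h k hk.1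
        rwa [Function.update_of_ne (by simpa using hk.2)] at this
      · split_ifs with hi
        · simpa using h i hi
        · trivial
    · rintro ⟨h1, h2⟩ k hk
      by_cases hki : k = i
      · subst hki
        simpa [hk] using h2
      · rw [Function.update_of_ne hki]
        exact h1 k ⟨by simpa using hk, by simpa using hki⟩
  rw [hset, Measure.prod_prod, Measure.infinitePi_pi _ (fun k _ => ht k)]
  split_ifs with hi
  · rw [Finset.prod_erase_mul s (fun k => μ (t k)) hi]
  · rw [measure_univ, mul_one, Finset.erase_eq_of_notMem hi]

theorem lintegral_infinitePi_eq_lintegral_update {ι : Type*} [DecidableEq ι] {X : Type*}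
    [MeasurableSpace X] (μ : Measure X) [IsProbabilityMeasure μ] (i : ι) {F : (ι → X) → ENNReal}
    (hF : Measurable F) :
    ∫⁻ ω, F ω ∂(Measure.infinitePi fun _ : ι => μ)
      = ∫⁻ ω, ∫⁻ θ, F (Function.update ω i θ) ∂μ ∂(Measure.infinitePi fun _ : ι => μ) := by
  have h := measurePreserving_update μ i
  rw [← h.lintegral_comp hF]
  exact lintegral_prod _ (hF.comp h.measurable).aemeasurable

theorem inv_le_mul_inv_of_le_mul {a b c : ENNReal} (hc0 : c ≠ 0) (hc : c ≠ ⊤) (h : a ≤ c * b) :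
    b⁻¹ ≤ c * a⁻¹ := by
  calc b⁻¹ = c * (c * b)⁻¹ := by
        rw [ENNReal.mul_inv (Or.inl hc0) (Or.inl hc), ← mul_assoc, ENNReal.mul_inv_cancel hc0 hc,
          one_mul]
    _ ≤ c * a⁻¹ := by gcongr

/-! ### One phase variable -/

theorem exists_toCircle_mul_norm (p : ℂ) :
    ∃ a : Torus, p = ‖p‖ * (AddCircle.toCircle a : ℂ) := by
  refine ⟨((Complex.arg p : ℝ) : Torus), ?_⟩
  rw [AddCircle.toCircle_apply_mk, div_self Real.two_pi_pos.ne', one_mul, Circle.coe_exp]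
  exact (Complex.norm_mul_exp_arg_mul_I p).symm

/-- This makes singular integrals uniform in the modulus of the parameter: it may be replaced by its
phase. -/
theorem norm_one_sub_le_two_mul {ρ : ℝ} (hρ : 0 ≤ ρ) {w : ℂ} (hw : ‖w‖ = 1) :
    ‖1 - w‖ ≤ 2 * ‖1 - ρ * w‖ := by
  have h1 : |1 - ρ| ≤ ‖1 - ρ * w‖ := by
    have := abs_norm_sub_norm_le (1 : ℂ) (ρ * w)
    simpa [hw, abs_of_nonneg hρ] using this
  calc ‖1 - w‖ = ‖(1 - ρ * w) - ((1 - ρ : ℝ) : ℂ) * w‖ := by push_cast; ring_nf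
    _ ≤ ‖1 - ρ * w‖ + ‖((1 - ρ : ℝ) : ℂ) * w‖ := norm_sub_le _ _
    _ ≤ ‖1 - ρ * w‖ + ‖1 - ρ * w‖ := by
      gcongr
      rw [norm_mul, hw, mul_one, Complex.norm_real, Real.norm_eq_abs]
      exact h1
    _ = _ := by ring

theorem lintegral_norm_one_sub_toCircle_rpow_lt_top {s : ℝ} (hs0 : 0 ≤ s) (hs : s < 1) :
    ∫⁻ θ : Torus, ‖1 - (AddCircle.toCircle θ : ℂ)‖ₑ ^ (-s) < ⊤ := by
  rw [← AddCircle.lintegral_preimage (2 * Real.pi) (-Real.pi)]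
  have hpi : -Real.pi + 2 * Real.pi = Real.pi := by ring
  rw [hpi]
  have hint : IntegrableOn (fun x : ℝ => (2 : ℝ) ^ s * ‖(x : ℂ) ^ ((-s : ℝ) : ℂ)‖)
      (Set.Ioc (-Real.pi) Real.pi) := by
    refine Integrable.const_mul ?_ _
    have := intervalIntegral.intervalIntegrable_cpow' (r := ((-s : ℝ) : ℂ)) (a := -Real.pi)
      (b := Real.pi) (by simpa using hs)
    exact ((intervalIntegrable_iff_integrableOn_Ioc_of_le
      (by linarith [Real.pi_pos])).1 this).norm
  refine lt_of_le_of_lt (lintegral_mono_ae ?_) hint.2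
  have h0 : ∀ᵐ x : ℝ ∂(volume.restrict (Set.Ioc (-Real.pi) Real.pi)), x ≠ 0 :=
    ae_restrict_of_ae (by simp [ae_iff])
  filter_upwards [h0, ae_restrict_mem measurableSet_Ioc] with x hx0 hx
  rw [AddCircle.toCircle_apply_mk, div_self Real.two_pi_pos.ne', one_mul, Circle.coe_exp]
  have hx' : |x / 2| ≤ Real.pi / 2 := by
    rw [abs_le]; constructor <;> linarith [hx.1, hx.2]
  -- Here `|1 - e^{ix}| = 2 |sin (x/2)|`; Jordan's inequality and `π ≤ 4` give the bound.
  have hlow : |x| / 2 ≤ ‖1 - Complex.exp (x * Complex.I)‖ := by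
    rw [norm_sub_rev, mul_comm, Complex.norm_exp_I_mul_ofReal_sub_one, norm_mul,
      Real.norm_eq_abs, Real.norm_eq_abs, abs_two]
    have h1 := Real.mul_abs_le_abs_sin hx'
    rw [abs_div, abs_two] at h1
    have h2 : (1 : ℝ) / 4 ≤ 1 / Real.pi := by
      gcongr
      exact Real.pi_le_four
    have h3 : 2 / Real.pi * (|x| / 2) = 1 / Real.pi * |x| := by ring
    nlinarith [abs_nonneg x]
  have hpos : 0 < |x| / 2 := by positivity
  rw [← ofReal_norm, ENNReal.ofReal_rpow_of_pos (hpos.trans_le hlow),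
    Real.enorm_of_nonneg (by positivity)]
  refine ENNReal.ofReal_le_ofReal ?_
  refine (Real.rpow_le_rpow_of_nonpos hpos hlow (by linarith)).trans (le_of_eq ?_)
  rw [Complex.norm_cpow_of_ne_zero (by exact_mod_cast hx0)]
  simp only [Complex.norm_real, Real.norm_eq_abs, Complex.ofReal_re, Complex.ofReal_im, mul_zero,
    Real.exp_zero, div_one]
  rw [Real.div_rpow (abs_nonneg x) zero_le_two, Real.rpow_neg zero_le_two, div_inv_eq_mul, mul_comm]

/-- The phase factor `e^{-iθ}`. -/
noncomputable def conjPhase (θ : Torus) : ℂ := (AddCircle.toCircle (-θ) : ℂ)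

theorem norm_conjPhase (θ : Torus) : ‖conjPhase θ‖ = 1 := Circle.norm_coe _

theorem continuous_conjPhase : Continuous conjPhase :=
  continuous_subtype_val.comp (AddCircle.continuous_toCircle.comp continuous_neg)

/-- Domination of `μ` by a multiple of Lebesgue measure and rotation invariance reduce all `p` to
one integrable singularity. The normalisation `1 ≤ K` is for later use. -/
theorem exists_lintegral_rpow_neg_le {μ : Measure Torus} [IsProbabilityMeasure μ]
    (hμ : HasBoundedDensity μ) {s : ℝ} (hs0 : 0 ≤ s) (hs : s < 1) :
    ∃ K : NNReal, 1 ≤ K ∧ ∀ p : ℂ, ∫⁻ θ, ‖1 - p * conjPhase θ‖ₑ ^ (-s) ∂μ ≤ K := by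
  obtain ⟨l, hl, -, hμl⟩ := hμ
  set L : ENNReal := eLpNorm l ⊤ volume
  set J := ∫⁻ θ : Torus, ‖1 - (AddCircle.toCircle θ : ℂ)‖ₑ ^ (-s) with hJ
  have hJt : J < ⊤ := lintegral_norm_one_sub_toCircle_rpow_lt_top hs0 hs
  have hB : 2 ^ s * (L * J) ≠ ⊤ :=
    ENNReal.mul_ne_top (ENNReal.rpow_ne_top_of_nonneg hs0 (by simp))
      (ENNReal.mul_ne_top hl.2.ne hJt.ne)
  have hmono : ∀ f : Torus → ENNReal, ∫⁻ θ, f θ ∂μ ≤ L * ∫⁻ θ, f θ := by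
    intro f
    have hle : μ ≤ L • (volume : Measure Torus) := by
      rw [hμl, ← withDensity_const]
      refine withDensity_mono ?_
      have := ae_le_eLpNormEssSup (f := l) (μ := (volume : Measure Torus))
      filter_upwards [this] with θ hθ
      rw [← eLpNorm_exponent_top] at hθ
      exact (Real.ofReal_le_enorm _).trans hθ
    calc ∫⁻ θ, f θ ∂μ ≤ ∫⁻ θ, f θ ∂(L • (volume : Measure Torus)) :=
          lintegral_mono' hle le_rfl
      _ = _ := by rw [lintegral_smul_measure, smul_eq_mul]
  refine ⟨max 1 (2 ^ s * (L * J)).toNNReal, le_max_left _ _, fun p => ?_⟩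
  obtain ⟨a, ha⟩ := exists_toCircle_mul_norm p
  have hpt : ∀ θ, ‖1 - p * conjPhase θ‖ₑ ^ (-s)
      ≤ 2 ^ s * ‖1 - (AddCircle.toCircle (a - θ) : ℂ)‖ₑ ^ (-s) := by
    intro θ
    have hw : ‖(AddCircle.toCircle (a - θ) : ℂ)‖ = 1 := Circle.norm_coe _
    have h := norm_one_sub_le_two_mul (norm_nonneg p) hw
    have he : p * conjPhase θ = ‖p‖ * (AddCircle.toCircle (a - θ) : ℂ) := by
      conv_lhs => rw [ha]
      rw [conjPhase, sub_eq_add_neg, AddCircle.toCircle_add, Circle.coe_mul, mul_assoc]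
    rw [← he] at h
    have h' : ‖1 - (AddCircle.toCircle (a - θ) : ℂ)‖ₑ ≤ 2 * ‖1 - p * conjPhase θ‖ₑ := by
      rw [← ofReal_norm, ← ofReal_norm, ← ENNReal.ofReal_ofNat 2, ← ENNReal.ofReal_mul zero_le_two]
      exact ENNReal.ofReal_le_ofReal h
    rw [ENNReal.rpow_neg, ENNReal.rpow_neg]
    have h2 := ENNReal.rpow_le_rpow h' hs0
    rw [ENNReal.mul_rpow_of_nonneg _ _ hs0] at h2
    exact inv_le_mul_inv_of_le_mul (ENNReal.rpow_pos (by simp) (by simp)).ne'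
      (ENNReal.rpow_ne_top_of_nonneg hs0 (by simp)) h2
  have hfin : ∫⁻ θ, ‖1 - p * conjPhase θ‖ₑ ^ (-s) ∂μ ≤ 2 ^ s * (L * J) := by
    refine (lintegral_mono hpt).trans ?_
    have htr : ∫⁻ θ : Torus, ‖1 - (AddCircle.toCircle (a - θ) : ℂ)‖ₑ ^ (-s) = J :=
      lintegral_sub_left_eq_self (fun θ : Torus => ‖1 - (AddCircle.toCircle θ : ℂ)‖ₑ ^ (-s)) a
    rw [lintegral_const_mul' _ _ (ENNReal.rpow_ne_top_of_nonneg hs0 (by simp)), ← htr]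
    gcongr
    exact hmono _
  refine hfin.trans ?_
  rw [← ENNReal.coe_toNNReal hB]
  exact_mod_cast le_max_right _ _

/-- The decoupling estimate. The left side is at most a constant, so it is enough to bound the right
integral below. There `|1 - p e^{-iθ}| ≤ 2`, which leaves the mean of `|1 - q e^{-iθ}|^s`; this
cannot be small because its negative moment is bounded. -/
theorem exists_lintegral_rpow_neg_le_mul {μ : Measure Torus} [IsProbabilityMeasure μ]
    (hμ : HasBoundedDensity μ) {s : ℝ} (hs0 : 0 < s) (hs : s < 1) :
    ∃ K : NNReal, ∀ p q : ℂ, ‖p‖ < 1 → ‖q‖ < 1 →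
      ∫⁻ θ, ‖1 - p * conjPhase θ‖ₑ ^ (-s) ∂μ
        ≤ K * ∫⁻ θ, ‖1 - q * conjPhase θ‖ₑ ^ s * ‖1 - p * conjPhase θ‖ₑ ^ (-s) ∂μ := by
  obtain ⟨K, hK1, hK⟩ := exists_lintegral_rpow_neg_le hμ hs0.le hs
  refine ⟨K * (2 ^ s * K), fun p q hp hq => ?_⟩
  set X := ∫⁻ θ, ‖1 - q * conjPhase θ‖ₑ ^ s * ‖1 - p * conjPhase θ‖ₑ ^ (-s) ∂μ with hX
  have hmeas : ∀ (r : ℝ) (q : ℂ), Measurable fun θ => ‖1 - q * conjPhase θ‖ₑ ^ r := by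
    intro r q
    have : Measurable conjPhase := continuous_conjPhase.measurable
    fun_prop
  have hK0 : (K : ENNReal) ≠ 0 := by
    have : (0 : NNReal) < K := lt_of_lt_of_le one_pos hK1
    exact_mod_cast this.ne'
  have hlow : 1 ≤ K * ∫⁻ θ, ‖1 - q * conjPhase θ‖ₑ ^ s ∂μ := by
    -- This is `2 ≤ t + 1/t`, scaled by `K` so that the second term integrates to at most `1`.
    have hpt : ∀ θ, (2 : ENNReal) ≤ K * ‖1 - q * conjPhase θ‖ₑ ^ s
        + (K : ENNReal)⁻¹ * ‖1 - q * conjPhase θ‖ₑ ^ (-s) := by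
      intro θ
      have hne : 1 - q * conjPhase θ ≠ 0 := by
        intro h
        have h1 : ‖q * conjPhase θ‖ = 1 := by rw [← sub_eq_zero.1 h, norm_one]
        rw [norm_mul, norm_conjPhase, mul_one] at h1
        exact hq.ne h1
      set t : ℝ := K * ‖1 - q * conjPhase θ‖ ^ s with ht
      have hKr : (0 : ℝ) < K := by exact_mod_cast lt_of_lt_of_le one_pos hK1
      have htpos : 0 < t := by positivity
      have e1 : (K : ENNReal) * ‖1 - q * conjPhase θ‖ₑ ^ s = ENNReal.ofReal t := by
        rw [ht, ENNReal.ofReal_mul hKr.le, ENNReal.ofReal_coe_nnreal,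
          ← ENNReal.ofReal_rpow_of_pos (norm_pos_iff.2 hne), ofReal_norm]
      have e2 : (K : ENNReal)⁻¹ * ‖1 - q * conjPhase θ‖ₑ ^ (-s) = ENNReal.ofReal t⁻¹ := by
        rw [ENNReal.ofReal_inv_of_pos htpos, ← e1, ENNReal.rpow_neg,
          ENNReal.mul_inv (Or.inl hK0) (Or.inl ENNReal.coe_ne_top)]
      rw [e1, e2, ← ENNReal.ofReal_add htpos.le (by positivity), ← ENNReal.ofReal_ofNat 2]
      refine ENNReal.ofReal_le_ofReal ?_
      have : t * t⁻¹ = 1 := mul_inv_cancel₀ htpos.ne'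
      nlinarith [sq_nonneg (t - 1), inv_pos.2 htpos, sq_nonneg (t - t⁻¹), sq_nonneg (t + t⁻¹ - 2)]
    have h2 : (2 : ENNReal) ≤ K * ∫⁻ θ, ‖1 - q * conjPhase θ‖ₑ ^ s ∂μ + 1 := by
      calc (2 : ENNReal) = ∫⁻ _, 2 ∂μ := by simp
        _ ≤ ∫⁻ θ, (K * ‖1 - q * conjPhase θ‖ₑ ^ s
            + (K : ENNReal)⁻¹ * ‖1 - q * conjPhase θ‖ₑ ^ (-s)) ∂μ := lintegral_mono hpt
        _ = K * ∫⁻ θ, ‖1 - q * conjPhase θ‖ₑ ^ s ∂μ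
            + (K : ENNReal)⁻¹ * ∫⁻ θ, ‖1 - q * conjPhase θ‖ₑ ^ (-s) ∂μ := by
          rw [lintegral_add_left ((hmeas s q).const_mul _), lintegral_const_mul _ (hmeas s q),
            lintegral_const_mul _ (hmeas _ q)]
        _ ≤ _ := by
          gcongr
          calc (K : ENNReal)⁻¹ * ∫⁻ θ, ‖1 - q * conjPhase θ‖ₑ ^ (-s) ∂μ
              ≤ (K : ENNReal)⁻¹ * K := by gcongr; exact hK q
            _ = 1 := ENNReal.inv_mul_cancel hK0 ENNReal.coe_ne_top
    rw [← one_add_one_eq_two] at h2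
    exact (ENNReal.add_le_add_iff_right ENNReal.one_ne_top).1 h2
  have hXlow : ∫⁻ θ, ‖1 - q * conjPhase θ‖ₑ ^ s ∂μ ≤ 2 ^ s * X := by
    rw [hX, ← lintegral_const_mul' _ _ (ENNReal.rpow_ne_top_of_nonneg hs0.le (by simp))]
    refine lintegral_mono fun θ => ?_
    have h2 : ‖1 - p * conjPhase θ‖ₑ ≤ 2 := by
      rw [← ofReal_norm, ← ENNReal.ofReal_ofNat 2]
      refine ENNReal.ofReal_le_ofReal ((norm_sub_le _ _).trans ?_)
      rw [norm_mul, norm_conjPhase, norm_one]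
      linarith
    have h3 : (1 : ENNReal) ≤ 2 ^ s * ‖1 - p * conjPhase θ‖ₑ ^ (-s) := by
      have := ENNReal.rpow_le_rpow h2 hs0.le
      rw [ENNReal.rpow_neg]
      simpa using inv_le_mul_inv_of_le_mul (b := 1) (ENNReal.rpow_pos (by simp) (by simp)).ne'
        (ENNReal.rpow_ne_top_of_nonneg hs0.le (by simp)) (by simpa using this)
    calc ‖1 - q * conjPhase θ‖ₑ ^ s = ‖1 - q * conjPhase θ‖ₑ ^ s * 1 := (mul_one _).symm
      _ ≤ ‖1 - q * conjPhase θ‖ₑ ^ s * (2 ^ s * ‖1 - p * conjPhase θ‖ₑ ^ (-s)) := by gcongr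
      _ = _ := by ring
  calc ∫⁻ θ, ‖1 - p * conjPhase θ‖ₑ ^ (-s) ∂μ ≤ K * 1 := by rw [mul_one]; exact hK p
    _ ≤ K * (K * ∫⁻ θ, ‖1 - q * conjPhase θ‖ₑ ^ s ∂μ) := by gcongr
    _ ≤ K * (K * (2 ^ s * X)) := by gcongr
    _ = _ := by
      rw [ENNReal.coe_mul, ENNReal.coe_mul, ENNReal.coe_rpow_of_nonneg _ hs0.le]
      push_cast
      ring

/-! ### Diagonal operators and unitarity -/

theorem summable_norm_sq {d : ℕ} (ψ : Hil d) : Summable fun i => ‖ψ i‖ ^ 2 := by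
  have := (lp.memℓp ψ).summable (by norm_num)
  simpa using this

theorem norm_sq_eq_tsum {d : ℕ} (ψ : Hil d) : ‖ψ‖ ^ 2 = ∑' i, ‖ψ i‖ ^ 2 := by
  have := lp.norm_rpow_eq_tsum (p := 2) (by norm_num) ψ
  simpa using this

/-- The closed unit disc, in which the weights of diagonal operators live. -/
abbrev Disc : Type := Metric.closedBall (0 : ℂ) 1

theorem Disc.norm_le (w : Disc) : ‖(w : ℂ)‖ ≤ 1 :=
  mem_closedBall_zero_iff.1 w.2

instance : Zero Disc := ⟨⟨0, by simp⟩⟩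

theorem Disc.coe_zero : ((0 : Disc) : ℂ) = 0 := rfl

/-- The diagonal operator with weights `w`. -/
noncomputable def diagOp {d : ℕ} (w : Label d → Disc) : Hil d →L[ℂ] Hil d :=
  wcomp id Function.injective_id (fun i => (w i : ℂ)) (fun i => (w i).norm_le)

theorem diagOp_apply {d : ℕ} (w : Label d → Disc) (ψ : Hil d) (i : Label d) :
    diagOp w ψ i = w i * ψ i := rfl

theorem norm_diagOp_le {d : ℕ} (w : Label d → Disc) : ‖diagOp w‖ ≤ 1 := by
  rw [diagOp, wcomp]
  exact LinearMap.mkContinuous_norm_le _ zero_le_one _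

theorem norm_diagOp_apply_le {d : ℕ} (w : Label d → Disc) (ψ : Hil d) : ‖diagOp w ψ‖ ≤ ‖ψ‖ := by
  simpa using (diagOp w).le_of_opNorm_le (norm_diagOp_le w) ψ

/-- Strong continuity for pointwise convergence of the weights, by dominated convergence of the
series. It is the source of measurability in `ω`. -/
theorem continuous_diagOp_apply {d : ℕ} (ψ : Hil d) :
    Continuous fun w : Label d → Disc => diagOp w ψ := by
  rw [continuous_iff_continuousAt]
  intro w₀
  have hsq : Continuous fun w : Label d → Disc => ‖diagOp w ψ - diagOp w₀ ψ‖ ^ 2 := by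
    simp only [norm_sq_eq_tsum]
    refine continuous_tsum (u := fun i => 4 * ‖ψ i‖ ^ 2) (fun i => ?_)
      ((summable_norm_sq ψ).mul_left 4) (fun i w => ?_)
    · simp only [lp.coeFn_sub, Pi.sub_apply, diagOp_apply]
      fun_prop
    · simp only [lp.coeFn_sub, Pi.sub_apply, diagOp_apply]
      rw [← sub_mul, norm_mul, mul_pow, Real.norm_of_nonneg (by positivity)]
      have : ‖(w i : ℂ) - w₀ i‖ ≤ 2 :=
        (norm_sub_le _ _).trans (by linarith [(w i).norm_le, (w₀ i).norm_le])
      gcongr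
      nlinarith [norm_nonneg ((w i : ℂ) - w₀ i)]
  have h : Continuous fun w : Label d → Disc => ‖diagOp w ψ - diagOp w₀ ψ‖ := by
    simpa [Real.sqrt_sq] using hsq.sqrt
  have := h.tendsto w₀
  rw [sub_self, norm_zero] at this
  exact tendsto_iff_norm_sub_tendsto_zero.2 this

theorem mem_unitary_of_norm_map {E : Type*} [NormedAddCommGroup E] [InnerProductSpace ℂ E]
    [CompleteSpace E] {V W : E →L[ℂ] E} (hV : ∀ ψ, ‖V ψ‖ = ‖ψ‖) (hVW : V * W = 1) :
    V ∈ unitary (E →L[ℂ] E) := by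
  have h : star V * V = 1 := (ContinuousLinearMap.norm_map_iff_adjoint_comp_self V).1 hV
  have hW : star V = W := by
    calc star V = star V * (V * W) := by rw [hVW, mul_one]
      _ = W := by rw [← mul_assoc, h, one_mul]
  exact Unitary.mem_iff.2 ⟨h, by rw [hW, hVW]⟩

theorem shiftOp_apply {d : ℕ} (ψ : Hil d) (i : Label d) :
    shiftOp d ψ i = ψ (i.1, i.2 - jump i.1) := one_mul _

theorem shiftOp_mem_unitary (d : ℕ) : shiftOp d ∈ unitary (Hil d →L[ℂ] Hil d) := by
  let e : Label d ≃ Label d :=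
    { toFun := fun i => (i.1, i.2 - jump i.1)
      invFun := fun i => (i.1, i.2 + jump i.1)
      left_inv := fun i => by simp
      right_inv := fun i => by simp }
  refine mem_unitary_of_norm_map
    (W := wcomp e.symm e.symm.injective (fun _ => 1) (fun _ => by simp)) (fun ψ => ?_) ?_
  · refine (sq_eq_sq₀ (norm_nonneg _) (norm_nonneg _)).1 ?_
    rw [norm_sq_eq_tsum, norm_sq_eq_tsum, ← e.tsum_eq fun i => ‖ψ i‖ ^ 2]
    refine tsum_congr fun i => ?_
    rw [shiftOp_apply]
    rfl
  · ext ψ i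
    change (1 : ℂ) * (1 * ψ (e.symm (e i))) = ψ i
    simp

theorem coinOp_mul {d : ℕ} (A B : Matrix (Coin d) (Coin d) ℂ) :
    coinOp A * coinOp B = coinOp (A * B) := by
  ext ψ ⟨τ, x⟩
  rw [mul_apply_eq_comp, coinOp_apply, coinOp_apply]
  simp only [coinOp_apply, Matrix.mul_apply, Finset.mul_sum, Finset.sum_mul]
  rw [Finset.sum_comm]
  simp only [mul_assoc]

theorem coinOp_one {d : ℕ} : coinOp (1 : Matrix (Coin d) (Coin d) ℂ) = 1 := by
  ext ψ ⟨τ, x⟩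
  rw [coinOp_apply]
  simp [Matrix.one_apply]

theorem toEuclideanCLM_mem_unitary {d : ℕ} {C : Matrix (Coin d) (Coin d) ℂ}
    (hC : C ∈ Matrix.unitaryGroup (Coin d) ℂ) :
    Matrix.toEuclideanCLM (𝕜 := ℂ) C ∈ unitary _ := by
  rw [Matrix.unitaryGroup] at hC
  obtain ⟨h1, h2⟩ := Unitary.mem_iff.1 hC
  refine Unitary.mem_iff.2 ⟨?_, ?_⟩
  · rw [← map_star, ← map_mul, h1, map_one]
  · rw [← map_star, ← map_mul, h2, map_one]

theorem coinOp_mem_unitary {d : ℕ} {C : Matrix (Coin d) (Coin d) ℂ}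
    (hC : C ∈ Matrix.unitaryGroup (Coin d) ℂ) : coinOp C ∈ unitary (Hil d →L[ℂ] Hil d) := by
  refine mem_unitary_of_norm_map (W := coinOp (star C)) (fun ψ => ?_) ?_
  · have hsum : ∀ φ : Hil d, ‖φ‖ ^ 2 = ∑' x, ∑ τ, ‖φ (τ, x)‖ ^ 2 := by
      intro φ
      rw [norm_sq_eq_tsum, ← (Equiv.prodComm (Site d) (Coin d)).tsum_eq]
      refine (Summable.tsum_prod ((Equiv.prodComm (Site d) (Coin d)).summable_iff.2
        (summable_norm_sq φ))).trans ?_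
      exact tsum_congr fun x => tsum_fintype _
    refine (sq_eq_sq₀ (norm_nonneg _) (norm_nonneg _)).1 ?_
    rw [hsum, hsum]
    refine tsum_congr fun x => ?_
    let v : EuclideanSpace ℂ (Coin d) := WithLp.toLp 2 fun σ => ψ (σ, x)
    have h := ContinuousLinearMap.norm_map_of_mem_unitary (toEuclideanCLM_mem_unitary hC) v
    have h2 := congrArg (· ^ 2) h
    simp only [EuclideanSpace.norm_sq_eq] at h2
    rw [← h2]
    refine Finset.sum_congr rfl fun τ _ => ?_
    rw [coinOp_apply]
    rfl
  · rw [coinOp_mul, ← coinOp_one]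
    congr 1
    exact (Unitary.mem_iff.1 hC).2

/-- The deterministic part `S (C ⊗ 𝕀)` of the evolution. -/
noncomputable def hop {d : ℕ} (C : Matrix (Coin d) (Coin d) ℂ) : Hil d →L[ℂ] Hil d :=
  shiftOp d * coinOp C

theorem hop_apply {d : ℕ} (C : Matrix (Coin d) (Coin d) ℂ) (ψ : Hil d) (τ : Coin d) (x : Site d) :
    hop C ψ (τ, x) = ∑ σ, C τ σ * ψ (σ, x - jump τ) := by
  rw [hop, mul_apply_eq_comp, shiftOp_apply, coinOp_apply]

theorem hop_mem_unitary {d : ℕ} {C : Matrix (Coin d) (Coin d) ℂ}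
    (hC : C ∈ Matrix.unitaryGroup (Coin d) ℂ) : hop C ∈ unitary (Hil d →L[ℂ] Hil d) :=
  mul_mem (shiftOp_mem_unitary d) (coinOp_mem_unitary hC)

theorem phaseOp_mem_unitary {d : ℕ} (ω : Phases d) : phaseOp ω ∈ unitary (Hil d →L[ℂ] Hil d) := by
  refine mem_unitary_of_norm_map (W := phaseOp (-ω)) (fun ψ => ?_) ?_
  · refine (sq_eq_sq₀ (norm_nonneg _) (norm_nonneg _)).1 ?_
    rw [norm_sq_eq_tsum, norm_sq_eq_tsum]
    refine tsum_congr fun i => ?_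
    rw [phaseOp, wcomp_apply, norm_mul, Circle.norm_coe, one_mul, id]
  · ext ψ i
    change (AddCircle.toCircle (ω i) : ℂ) * (AddCircle.toCircle (-ω i) * ψ i) = ψ i
    rw [← mul_assoc, ← Circle.coe_mul, ← AddCircle.toCircle_add, add_neg_cancel,
      AddCircle.toCircle_zero]
    simp

theorem walk_mem_unitary {d : ℕ} (ω : Phases d) {C : Matrix (Coin d) (Coin d) ℂ}
    (hC : C ∈ Matrix.unitaryGroup (Coin d) ℂ) : walk ω C ∈ unitary (Hil d →L[ℂ] Hil d) :=
  mul_mem (phaseOp_mem_unitary ω) (hop_mem_unitary hC)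

theorem isUnit_walk_sub {d : ℕ} (ω : Phases d) {C : Matrix (Coin d) (Coin d) ℂ}
    (hC : C ∈ Matrix.unitaryGroup (Coin d) ℂ) {z : ℂ} (hz : ‖z‖ ≠ 1) :
    IsUnit (walk ω C - z • ContinuousLinearMap.id ℂ (Hil d)) := by
  have h : z ∉ spectrum ℂ (walk ω C) := fun h =>
    hz (by simpa using Unitary.spectrum_subset_circle (𝕜 := ℂ) ⟨_, walk_mem_unitary ω hC⟩ h)
  rw [spectrum.notMem_iff, Algebra.algebraMap_eq_smul_one] at h
  rw [← neg_sub, IsUnit.neg_iff]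
  exact h

/-! ### Green functions of a unitary minus a diagonal operator -/

/-- The standard basis vector with label `j`. -/
noncomputable def basisVec {d : ℕ} (j : Label d) : Hil d := lp.single 2 j 1

theorem basisVec_apply {d : ℕ} (i j : Label d) : basisVec j i = if i = j then 1 else 0 := by
  rw [basisVec, lp.single_apply]
  by_cases h : i = j
  · subst h; simp
  · simp [h]

theorem norm_basisVec {d : ℕ} (j : Label d) : ‖basisVec j‖ = 1 := by
  rw [basisVec, lp.norm_single (by norm_num), norm_one]

/-- The operator `V - z D` with `D` diagonal. -/
noncomputable def pencil {d : ℕ} (V : Hil d →L[ℂ] Hil d) (z : ℂ) (w : Label d → Disc) :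
    Hil d →L[ℂ] Hil d := V - z • diagOp w

/-- Factoring out `V` leaves a Neumann series, since the diagonal part has norm at most `|z| < 1`.
-/
theorem isUnit_pencil {d : ℕ} {V : Hil d →L[ℂ] Hil d} (hV : V ∈ unitary (Hil d →L[ℂ] Hil d))
    {z : ℂ} (hz : ‖z‖ < 1) (w : Label d → Disc) : IsUnit (pencil V z w) := by
  obtain ⟨h1, h2⟩ := Unitary.mem_iff.1 hV
  have hn : ‖star V * (z • diagOp w)‖ < 1 := by
    refine lt_of_le_of_lt ?_ hz
    refine ContinuousLinearMap.opNorm_le_bound _ (norm_nonneg _) fun ψ => ?_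
    rw [mul_apply_eq_comp,
      ContinuousLinearMap.norm_map_of_mem_unitary (Unitary.star_mem hV), _root_.smul_apply,
      norm_smul]
    gcongr
    exact norm_diagOp_apply_le w ψ
  have he : pencil V z w = V * (1 - star V * (z • diagOp w)) := by
    rw [mul_sub, mul_one, ← mul_assoc, h2, one_mul, pencil]
  rw [he]
  exact (Unitary.isUnit_coe (U := ⟨V, hV⟩)).mul (isUnit_one_sub_of_norm_lt_one hn)

/-- The Green function `⟨i, (V - z D)⁻¹ j⟩`. -/
noncomputable def green {d : ℕ} (V : Hil d →L[ℂ] Hil d) (z : ℂ) (w : Label d → Disc)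
    (i j : Label d) : ℂ := Ring.inverse (pencil V z w) (basisVec j) i

theorem pencil_inverse_apply {d : ℕ} {V : Hil d →L[ℂ] Hil d}
    (hV : V ∈ unitary (Hil d →L[ℂ] Hil d)) {z : ℂ} (hz : ‖z‖ < 1) (w : Label d → Disc)
    (ψ : Hil d) : pencil V z w (Ring.inverse (pencil V z w) ψ) = ψ := by
  rw [← mul_apply_eq_comp, Ring.mul_inverse_cancel _ (isUnit_pencil hV hz w)]
  rfl

theorem norm_le_norm_pencil {d : ℕ} {V : Hil d →L[ℂ] Hil d}
    (hV : V ∈ unitary (Hil d →L[ℂ] Hil d)) (z : ℂ) (w : Label d → Disc)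
    (ψ : Hil d) : (1 - ‖z‖) * ‖ψ‖ ≤ ‖pencil V z w ψ‖ := by
  have h1 : ‖V ψ‖ = ‖ψ‖ := ContinuousLinearMap.norm_map_of_mem_unitary hV ψ
  have h2 : ‖(z • diagOp w) ψ‖ ≤ ‖z‖ * ‖ψ‖ := by
    rw [_root_.smul_apply, norm_smul]
    gcongr
    exact norm_diagOp_apply_le w ψ
  have h3 := norm_sub_norm_le (V ψ) ((z • diagOp w) ψ)
  rw [pencil, _root_.sub_apply]
  linarith

/-- The resolvent identity and the uniform bound `1 / (1 - |z|)` leave only the diagonal operators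
applied to the fixed vector `ψ`, where strong continuity suffices. -/
theorem continuous_green {d : ℕ} {V : Hil d →L[ℂ] Hil d} (hV : V ∈ unitary (Hil d →L[ℂ] Hil d))
    {z : ℂ} (hz : ‖z‖ < 1) (i j : Label d) : Continuous fun w => green V z w i j := by
  rw [continuous_iff_continuousAt]
  intro w₀
  set ψ := Ring.inverse (pencil V z w₀) (basisVec j) with hψ
  have hpos : 0 < 1 - ‖z‖ := by linarith
  have hbound : ∀ w, ‖green V z w i j - green V z w₀ i j‖
      ≤ (1 - ‖z‖)⁻¹ * ‖z • (diagOp w ψ - diagOp w₀ ψ)‖ := by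
    intro w
    have h1 : ‖green V z w i j - green V z w₀ i j‖
        ≤ ‖Ring.inverse (pencil V z w) (basisVec j) - ψ‖ :=
      lp.norm_apply_le_norm (by norm_num) (Ring.inverse (pencil V z w) (basisVec j) - ψ) i
    refine h1.trans ?_
    rw [inv_mul_eq_div, le_div_iff₀ hpos, mul_comm]
    refine (norm_le_norm_pencil hV z w _).trans (le_of_eq ?_)
    rw [map_sub, pencil_inverse_apply hV hz, ← pencil_inverse_apply hV hz w₀ (basisVec j), ← hψ]
    congr 1
    simp only [pencil, _root_.sub_apply, _root_.smul_apply, smul_sub]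
    abel
  refine tendsto_iff_norm_sub_tendsto_zero.2 (squeeze_zero (fun _ => norm_nonneg _) hbound ?_)
  have hc : Continuous fun w => (1 - ‖z‖)⁻¹ * ‖z • (diagOp w ψ - diagOp w₀ ψ)‖ := by
    have := continuous_diagOp_apply ψ
    fun_prop
  simpa using hc.tendsto w₀

/-! ### Rank one perturbations -/

theorem inner_basisVec {d : ℕ} (j : Label d) (ψ : Hil d) : inner ℂ (basisVec j) ψ = ψ j := by
  rw [basisVec, lp.inner_single_left]
  simp

theorem norm_sq_smul_basisVec_add {d : ℕ} (a : ℂ) (j : Label d) {ψ : Hil d} (hψ : ψ j = 0) :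
    ‖a • basisVec j + ψ‖ ^ 2 = ‖a‖ ^ 2 + ‖ψ‖ ^ 2 := by
  have h : inner ℂ (a • basisVec j) ψ = 0 := by rw [inner_smul_left, inner_basisVec, hψ, mul_zero]
  have := norm_add_sq_eq_norm_sq_add_norm_sq_of_inner_eq_zero (𝕜 := ℂ) _ _ h
  rw [sq, this, norm_smul, norm_basisVec, mul_one, sq, sq]

theorem pencil_apply {d : ℕ} (V : Hil d →L[ℂ] Hil d) (z : ℂ) (w : Label d → Disc) (ψ : Hil d) :
    pencil V z w ψ = V ψ - z • diagOp w ψ := rfl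

theorem diagOp_update_zero {d : ℕ} (w : Label d → Disc) (k : Label d) (ψ : Hil d) :
    diagOp w ψ = diagOp (Function.update w k 0) ψ + ((w k : ℂ) * ψ k) • basisVec k := by
  ext i
  simp only [lp.coeFn_add, lp.coeFn_smul, Pi.add_apply, Pi.smul_apply, diagOp_apply, smul_eq_mul,
    basisVec_apply]
  by_cases h : i = k
  · subst h; simp
  · simp [h]

theorem pencil_injective {d : ℕ} {V : Hil d →L[ℂ] Hil d} (hV : V ∈ unitary (Hil d →L[ℂ] Hil d))
    {z : ℂ} (hz : ‖z‖ < 1) (w : Label d → Disc) : Function.Injective (pencil V z w) := by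
  refine (injective_iff_map_eq_zero _).2 fun ψ h => ?_
  have := norm_le_norm_pencil hV z w ψ
  rw [h, norm_zero] at this
  have h2 : 0 < 1 - ‖z‖ := by linarith
  exact norm_le_zero_iff.1 (nonpos_of_mul_nonpos_right this h2)

/-- A Pythagoras argument giving a bound independent of `z`. As `w j = 0`, `V ψ = e_j + z D ψ` is an
orthogonal sum, so `‖ψ‖² = 1 + |z|² ‖Dψ‖²`; as `w i = 0`, `|ψ i|² + ‖Dψ‖² ≤ ‖ψ‖²`. -/
theorem norm_green_le_one {d : ℕ} {V : Hil d →L[ℂ] Hil d} (hV : V ∈ unitary (Hil d →L[ℂ] Hil d))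
    {z : ℂ} (hz : ‖z‖ < 1) {w : Label d → Disc} {i j : Label d} (hi : w i = 0) (hj : w j = 0) :
    ‖green V z w i j‖ ≤ 1 := by
  set ψ := Ring.inverse (pencil V z w) (basisVec j) with hψ
  have hVψ : V ψ = (1 : ℂ) • basisVec j + z • diagOp w ψ := by
    have := pencil_inverse_apply hV hz w (basisVec j)
    rw [← hψ, pencil_apply] at this
    rw [one_smul, ← this]
    abel
  have h1 : ‖ψ‖ ^ 2 = 1 + ‖z‖ ^ 2 * ‖diagOp w ψ‖ ^ 2 := by
    rw [← ContinuousLinearMap.norm_map_of_mem_unitary hV ψ, hVψ, norm_sq_smul_basisVec_add,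
      norm_smul, norm_one, mul_pow, one_pow]
    rw [lp.coeFn_smul, Pi.smul_apply, diagOp_apply, hj, Disc.coe_zero, zero_mul, smul_zero]
  have h2 : ‖ψ i‖ ^ 2 + ‖diagOp w ψ‖ ^ 2 ≤ ‖ψ‖ ^ 2 := by
    rw [← norm_sq_smul_basisVec_add (ψ i) i (ψ := diagOp w ψ)
      (by rw [diagOp_apply, hi, Disc.coe_zero, zero_mul])]
    have hw : Function.update w i 0 = w := by rw [← hi, Function.update_eq_self]
    -- With weight `1` at `i` the diagonal operator is still a contraction, and it sends `ψ` to `Dψ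
    -- + ψ i e_i`.
    have := diagOp_update_zero (Function.update w i ⟨1, by simp⟩) i ψ
    rw [Function.update_idem, hw, Function.update_self,
      one_mul, add_comm] at this
    rw [← this]
    gcongr
    exact norm_diagOp_apply_le _ _
  have h3 : ‖z‖ ^ 2 * ‖diagOp w ψ‖ ^ 2 ≤ ‖diagOp w ψ‖ ^ 2 :=
    mul_le_of_le_one_left (by positivity) (pow_le_one₀ (norm_nonneg _) hz.le)
  have h4 : ‖ψ i‖ ^ 2 ≤ 1 := by linarith
  exact (sq_le_one_iff₀ (norm_nonneg _)).1 h4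

theorem green_eq_of_left {d : ℕ} {V : Hil d →L[ℂ] Hil d} (hV : V ∈ unitary (Hil d →L[ℂ] Hil d))
    {z : ℂ} (hz : ‖z‖ < 1) (w : Label d → Disc) (i j : Label d) :
    green V z w i j = green V z (Function.update w i 0) i j * (1 + z * w i * green V z w i i) := by
  set w' := Function.update w i 0 with hw'
  set ψ' := Ring.inverse (pencil V z w') (basisVec j) with hψ'
  set η := Ring.inverse (pencil V z w) (basisVec i) with hη
  have h : Ring.inverse (pencil V z w) (basisVec j) = ψ' + (z * w i * ψ' i) • η := by
    apply pencil_injective hV hz w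
    rw [pencil_inverse_apply hV hz, map_add, map_smul, hη, pencil_inverse_apply hV hz,
      pencil_apply, diagOp_update_zero w i, smul_add, ← sub_sub, ← hw', ← pencil_apply, hψ',
      pencil_inverse_apply hV hz, smul_smul, mul_assoc, sub_add_cancel]
  have h2 := congrArg (fun φ : Hil d => φ i) h
  simp only [lp.coeFn_add, lp.coeFn_smul, Pi.add_apply, Pi.smul_apply, smul_eq_mul] at h2
  rw [green, h2, green, green, ← hψ', ← hη]
  ring

theorem green_eq_of_right {d : ℕ} {V : Hil d →L[ℂ] Hil d} (hV : V ∈ unitary (Hil d →L[ℂ] Hil d))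
    {z : ℂ} (hz : ‖z‖ < 1) (w : Label d → Disc) (i j : Label d) :
    green V z w i j = green V z (Function.update w j 0) i j * (1 + z * w j * green V z w j j) := by
  set w' := Function.update w j 0 with hw'
  set ψ' := Ring.inverse (pencil V z w') (basisVec j) with hψ'
  set ψ := Ring.inverse (pencil V z w) (basisVec j) with hψ
  have h : ψ = (1 + z * w j * ψ j) • ψ' := by
    apply pencil_injective hV hz w'
    have h0 := pencil_inverse_apply hV hz w (basisVec j)
    rw [← hψ, pencil_apply, diagOp_update_zero w j, ← hw'] at h0
    rw [map_smul, hψ', pencil_inverse_apply hV hz, pencil_apply]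
    linear_combination (norm := module) h0
  have h2 := congrArg (fun φ : Hil d => φ i) h
  simp only [lp.coeFn_smul, Pi.smul_apply, smul_eq_mul] at h2
  rw [green, ← hψ, h2, green, green, ← hψ', ← hψ]
  ring

/-- The dependence on the weight at `k` is a fractional linear function: the diagonal identity `g =
g' (1 + z v g)` makes `1 + z v g` and `1 - z g' v` mutually inverse. -/
theorem green_update_mul {d : ℕ} {V : Hil d →L[ℂ] Hil d} (hV : V ∈ unitary (Hil d →L[ℂ] Hil d))
    {z : ℂ} (hz : ‖z‖ < 1) (w : Label d → Disc) {i j k : Label d} (hk : k = i ∨ k = j)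
    (v : Disc) :
    green V z (Function.update w k v) i j * (1 - z * green V z (Function.update w k 0) k k * v)
      = green V z (Function.update w k 0) i j := by
  have h1 := green_eq_of_left hV hz (Function.update w k v) k k
  have h2 : green V z (Function.update w k v) i j = green V z (Function.update w k 0) i j
      * (1 + z * v * green V z (Function.update w k v) k k) := by
    rcases hk with rfl | rfl
    · simpa using green_eq_of_left hV hz (Function.update w k v) k j
    · simpa using green_eq_of_right hV hz (Function.update w k v) i k
  rw [Function.update_self, Function.update_idem] at h1
  set g := green V z (Function.update w k v) k k
  set g' := green V z (Function.update w k 0) k k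
  rw [h2]
  linear_combination (-z * v) * green V z (Function.update w k 0) i j * (-1) * h1

theorem enorm_green_update_rpow {d : ℕ} {V : Hil d →L[ℂ] Hil d}
    (hV : V ∈ unitary (Hil d →L[ℂ] Hil d)) {z : ℂ} (hz : ‖z‖ < 1) (w : Label d → Disc)
    {i j k : Label d} (hk : k = i ∨ k = j) (v : Disc) {s : ℝ} (hs : 0 ≤ s) :
    ‖z * green V z (Function.update w k 0) k k‖ < 1 ∧
    ‖green V z (Function.update w k v) i j‖ₑ ^ s = ‖green V z (Function.update w k 0) i j‖ₑ ^ s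
      * ‖1 - z * green V z (Function.update w k 0) k k * v‖ₑ ^ (-s) := by
  have hp : ‖z * green V z (Function.update w k 0) k k‖ < 1 := by
    rw [norm_mul]
    refine lt_of_le_of_lt (mul_le_of_le_one_right (norm_nonneg _) ?_) hz
    exact norm_green_le_one hV hz (by simp) (by simp)
  refine ⟨hp, ?_⟩
  have hne : 1 - z * green V z (Function.update w k 0) k k * v ≠ 0 := by
    intro h
    have h1 : ‖z * green V z (Function.update w k 0) k k * (v : ℂ)‖ = 1 := by
      rw [← sub_eq_zero.1 h, norm_one]
    rw [norm_mul] at h1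
    exact absurd h1 (lt_of_le_of_lt (mul_le_of_le_one_right (norm_nonneg _) v.norm_le) hp).ne
  rw [← green_update_mul hV hz w hk v, enorm_mul, ENNReal.mul_rpow_of_nonneg _ _ hs, mul_assoc,
    ENNReal.rpow_neg, ENNReal.mul_inv_cancel, mul_one]
  · simpa [ENNReal.rpow_eq_zero_iff, hs.not_gt] using fun h => absurd h hne
  · exact ENNReal.rpow_ne_top_of_nonneg hs (by simp)

/-! ### Averages over the phases -/

/-- The weights `e^{-iω}`. -/
noncomputable def weights {d : ℕ} (ω : Phases d) (i : Label d) : Disc :=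
  ⟨conjPhase (ω i), by simp [norm_conjPhase]⟩

theorem continuous_weights {d : ℕ} : Continuous (weights : Phases d → Label d → Disc) :=
  continuous_pi fun i => (continuous_conjPhase.comp (continuous_apply i)).subtype_mk _

theorem weights_update {d : ℕ} (ω : Phases d) (k : Label d) (θ : Torus) :
    weights (Function.update ω k θ)
      = Function.update (weights ω) k ⟨conjPhase θ, by simp [norm_conjPhase]⟩ := by
  ext i
  by_cases h : i = k
  · subst h; simp [weights]
  · simp [weights, h]

theorem measurable_green {d : ℕ} {V : Hil d →L[ℂ] Hil d} (hV : V ∈ unitary (Hil d →L[ℂ] Hil d))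
    {z : ℂ} (hz : ‖z‖ < 1) (i j : Label d) :
    Measurable fun ω : Phases d => green V z (weights ω) i j :=
  ((continuous_green hV hz i j).comp continuous_weights).measurable

/-- Averaging the phase at `i` and then the one at `j` costs a factor `K` each, and leaves a Green
function with both weights zero, bounded by `1`. For `i = j` one averaging is enough. -/
theorem lintegral_green_rpow_le {d : ℕ} {V : Hil d →L[ℂ] Hil d}
    (hV : V ∈ unitary (Hil d →L[ℂ] Hil d)) {z : ℂ} (hz : ‖z‖ < 1)
    {μ : Measure Torus} [IsProbabilityMeasure μ] {s : ℝ} (hs : 0 ≤ s) {K : NNReal} (hK1 : 1 ≤ K)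
    (hK : ∀ p : ℂ, ∫⁻ θ, ‖1 - p * conjPhase θ‖ₑ ^ (-s) ∂μ ≤ K) (i j : Label d) :
    ∫⁻ ω, ‖green V z (weights ω) i j‖ₑ ^ s ∂(phaseLaw d μ) ≤ K * K := by
  have hone : ∀ w : Label d → Disc, w i = 0 → w j = 0 → ‖green V z w i j‖ₑ ^ s ≤ 1 := by
    intro w h1 h2
    have : ‖green V z w i j‖ₑ ≤ 1 := by
      rw [← ofReal_norm, ← ENNReal.ofReal_one]
      exact ENNReal.ofReal_le_ofReal (norm_green_le_one hV hz h1 h2)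
    simpa using ENNReal.rpow_le_rpow this hs
  have hstep : ∀ (w : Label d → Disc) (k : Label d), k = i ∨ k = j →
      ∫⁻ θ, ‖green V z (Function.update w k ⟨conjPhase θ, by simp [norm_conjPhase]⟩) i j‖ₑ ^ s ∂μ
        ≤ K * ‖green V z (Function.update w k 0) i j‖ₑ ^ s := by
    intro w k hk
    rw [lintegral_congr fun θ => (enorm_green_update_rpow hV hz w hk
      ⟨conjPhase θ, by simp [norm_conjPhase]⟩ hs).2,
      lintegral_const_mul' _ _ (ENNReal.rpow_ne_top_of_nonneg hs (by simp)), mul_comm]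
    gcongr
    exact hK _
  rw [phaseLaw, lintegral_infinitePi_eq_lintegral_update μ i
    ((measurable_green hV hz i j).enorm.pow_const s)]
  have hm : Measurable fun ω : Phases d =>
      ‖green V z (Function.update (weights ω) i 0) i j‖ₑ ^ s :=
    (((continuous_green hV hz i j).comp (continuous_weights.update i continuous_const)).measurable
      ).enorm.pow_const s
  calc _ ≤ ∫⁻ ω, K * ‖green V z (Function.update (weights ω) i 0) i j‖ₑ ^ s
        ∂(Measure.infinitePi fun _ : Label d => μ) := by
        refine lintegral_mono fun ω => ?_
        simp only [weights_update]
        exact hstep _ i (Or.inl rfl)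
    _ = K * ∫⁻ ω, ‖green V z (Function.update (weights ω) i 0) i j‖ₑ ^ s
        ∂(Measure.infinitePi fun _ : Label d => μ) := lintegral_const_mul _ hm
    _ ≤ K * K := by
        gcongr
        by_cases hij : i = j
        · subst hij
          calc _ ≤ ∫⁻ _, 1 ∂(Measure.infinitePi fun _ : Label d => μ) :=
                lintegral_mono fun ω => hone _ (by simp) (by simp)
            _ = 1 := by simp
            _ ≤ K := by exact_mod_cast hK1
        · rw [lintegral_infinitePi_eq_lintegral_update μ j hm]
          calc _ ≤ ∫⁻ _, K ∂(Measure.infinitePi fun _ : Label d => μ) := by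
                refine lintegral_mono fun ω => ?_
                simp only [weights_update, Function.update_comm (Ne.symm hij)]
                refine (hstep _ j (Or.inr rfl)).trans ?_
                refine mul_le_of_le_one_right' (hone _ ?_ (by simp))
                simp [Function.update_of_ne hij]
            _ = K := by simp

/-- With all phases but that at `i` frozen, `q` is constant and `G` is `a / (1 - p e^{-iθ})`, so the
one-variable estimate applies. -/
theorem lintegral_green_rpow_le_decoupled {d : ℕ} {V : Hil d →L[ℂ] Hil d}
    (hV : V ∈ unitary (Hil d →L[ℂ] Hil d)) {z : ℂ} (hz : ‖z‖ < 1)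
    {μ : Measure Torus} [IsProbabilityMeasure μ] {s : ℝ} (hs : 0 ≤ s) {K : NNReal}
    (hK : ∀ p q : ℂ, ‖p‖ < 1 → ‖q‖ < 1 → ∫⁻ θ, ‖1 - p * conjPhase θ‖ₑ ^ (-s) ∂μ
        ≤ K * ∫⁻ θ, ‖1 - q * conjPhase θ‖ₑ ^ s * ‖1 - p * conjPhase θ‖ₑ ^ (-s) ∂μ)
    (i j : Label d) {q : Phases d → ℂ} (hqm : Measurable q) (hq1 : ∀ ω, ‖q ω‖ < 1)
    (hq : ∀ ω θ, q (Function.update ω i θ) = q ω) :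
    ∫⁻ ω, ‖green V z (weights ω) i j‖ₑ ^ s ∂(phaseLaw d μ)
      ≤ K * ∫⁻ ω, ‖(1 - q ω * weights ω i) * green V z (weights ω) i j‖ₑ ^ s
        ∂(phaseLaw d μ) := by
  have hm := measurable_green hV hz i j
  have hwm : Measurable fun ω : Phases d => (weights ω i : ℂ) :=
    continuous_conjPhase.measurable.comp (measurable_pi_apply i)
  have hm2 : Measurable fun ω =>
      ‖(1 - q ω * weights ω i) * green V z (weights ω) i j‖ₑ ^ s := by fun_prop
  rw [phaseLaw, lintegral_infinitePi_eq_lintegral_update μ i (hm.enorm.pow_const s),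
    lintegral_infinitePi_eq_lintegral_update μ i hm2, ← lintegral_const_mul' _ _ ENNReal.coe_ne_top]
  refine lintegral_mono fun ω => ?_
  have hg := fun θ => (enorm_green_update_rpow hV hz (weights ω) (Or.inl rfl : i = i ∨ i = j)
    ⟨conjPhase θ, by simp [norm_conjPhase]⟩ hs).2
  simp only [weights_update, hq, Function.update_self, enorm_mul, ENNReal.mul_rpow_of_nonneg _ _ hs,
    hg]
  set a := ‖green V z (Function.update (weights ω) i 0) i j‖ₑ ^ s
  set p := z * green V z (Function.update (weights ω) i 0) i i
  have ha : a ≠ ⊤ := ENNReal.rpow_ne_top_of_nonneg hs (by simp)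
  have hp : ‖p‖ < 1 :=
    (enorm_green_update_rpow hV hz (weights ω) (Or.inl rfl : i = i ∨ i = j) 0 hs).1
  simp only [mul_left_comm _ a]
  rw [lintegral_const_mul' _ _ ha, lintegral_const_mul' _ _ ha, mul_left_comm]
  gcongr
  exact hK p (q ω) hp (hq1 ω)

/-! ### Transport around the cycles of the permutation -/

/-- The label `(π τ, x + r(π τ))` to which the unperturbed walk sends `(τ, x)`. -/
def transport {d : ℕ} (π : Equiv.Perm (Coin d)) (i : Label d) : Label d :=
  (π i.1, i.2 + jump (π i.1))

theorem transport_iterate {d : ℕ} (π : Equiv.Perm (Coin d)) (n : ℕ) (i : Label d) :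
    (transport π)^[n] i
      = ((π ^ n) i.1, i.2 + ∑ k ∈ Finset.range n, jump ((π ^ (k + 1)) i.1)) := by
  induction n with
  | zero => simp
  | succ n ih =>
    rw [Function.iterate_succ_apply', ih, transport, Finset.sum_range_succ, pow_succ' π n, add_assoc]
    rfl

theorem minimalPeriod_perm_pos {d : ℕ} (π : Equiv.Perm (Coin d)) (τ : Coin d) :
    0 < Function.minimalPeriod π τ :=
  Function.minimalPeriod_pos_of_mem_periodicPts (π.injective.mem_periodicPts τ)

theorem transport_iterate_minimalPeriod {d : ℕ} {π : Equiv.Perm (Coin d)} (hπ : JumpsCancel π)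
    (i : Label d) : (transport π)^[Function.minimalPeriod π i.1] i = i := by
  have h1 : (π ^ Function.minimalPeriod π i.1) i.1 = i.1 := by
    rw [← Equiv.Perm.iterate_eq_pow]
    exact Function.iterate_minimalPeriod
  rw [transport_iterate, h1]
  -- The displacement sums the jumps from `π τ` on, the hypothesis from `τ` on; over a full period
  -- the two sums agree.
  have h2 := Finset.sum_range_succ' (fun k => jump ((π ^ k) i.1)) (Function.minimalPeriod π i.1)
  rw [Finset.sum_range_succ, hπ i.1, h1, zero_add, pow_zero, Equiv.Perm.one_apply] at h2
  have h3 := right_eq_add.1 h2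
  rw [h3, add_zero]

theorem transport_iterate_ne {d : ℕ} (π : Equiv.Perm (Coin d)) (i : Label d) {n : ℕ}
    (hn0 : 0 < n) (hn : n < Function.minimalPeriod π i.1) : (transport π)^[n] i ≠ i := by
  intro h
  rw [transport_iterate] at h
  refine Function.not_isPeriodicPt_of_pos_of_lt_minimalPeriod hn0.ne' hn ?_
  have := congrArg Prod.fst h
  rwa [← Equiv.Perm.iterate_eq_pow] at this

theorem norm_jump_le {d : ℕ} (τ : Coin d) : ‖jump τ‖ ≤ 1 := by
  refine (pi_norm_le_iff_of_nonneg zero_le_one).2 fun k => ?_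
  rw [jump]
  by_cases h : k = τ.1
  · subst h
    rw [Pi.single_eq_same]
    rcases Int.units_eq_one_or τ.2 with h | h <;> simp [h]
  · simp [Pi.single_eq_of_ne h]

theorem norm_transport_iterate_sub_le {d : ℕ} (π : Equiv.Perm (Coin d)) (n : ℕ) (i : Label d) :
    ‖((transport π)^[n] i).2 - i.2‖ ≤ n := by
  rw [transport_iterate, add_sub_cancel_left]
  refine (norm_sum_le _ _).trans ((Finset.sum_le_sum fun k _ => norm_jump_le _).trans ?_)
  simp

theorem hop_apply_transport {d : ℕ} (C : Matrix (Coin d) (Coin d) ℂ) (π : Equiv.Perm (Coin d))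
    (ψ : Hil d) (i : Label d) :
    hop C ψ (transport π i)
      = ψ i + ∑ σ, (C - permCoin π) (π i.1) σ * ψ (σ, i.2) := by
  obtain ⟨τ, x⟩ := i
  rw [transport, hop_apply]
  simp only [Matrix.sub_apply, sub_mul, Finset.sum_sub_distrib, permCoin, Matrix.of_apply,
    add_sub_cancel_right]
  simp

theorem norm_entry_le_coinNorm {d : ℕ} (A : Matrix (Coin d) (Coin d) ℂ) (τ σ : Coin d) :
    ‖A τ σ‖ ≤ coinNorm A := by
  have h := (Matrix.toEuclideanCLM (𝕜 := ℂ) A).le_opNorm (EuclideanSpace.single σ 1)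
  rw [PiLp.norm_single, norm_one, mul_one] at h
  refine le_trans ?_ h
  refine le_trans (le_of_eq ?_) (PiLp.norm_apply_le _ τ)
  simp [EuclideanSpace.single]

theorem rpow_sum_le_sum_rpow {ι : Type*} (t : Finset ι) (f : ι → ENNReal) {s : ℝ} (hs0 : 0 < s)
    (hs1 : s ≤ 1) : (∑ k ∈ t, f k) ^ s ≤ ∑ k ∈ t, f k ^ s := by
  classical
  induction t using Finset.induction_on with
  | empty => simp [hs0]
  | insert a t ha ih =>
    rw [Finset.sum_insert ha, Finset.sum_insert ha]
    exact (ENNReal.rpow_add_le_add_rpow _ _ hs0.le hs1).trans (by gcongr)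

/-- Row `transport π i` of the equation `(V - z D) G = 1`; off `j` the right side vanishes. -/
theorem green_eq_transport {d : ℕ} {C : Matrix (Coin d) (Coin d) ℂ}
    (hC : C ∈ Matrix.unitaryGroup (Coin d) ℂ) {π : Equiv.Perm (Coin d)} {z : ℂ} (hz : ‖z‖ < 1)
    (w : Label d → Disc) {j : Label d} {i : Label d} (hij : transport π i ≠ j) :
    green (hop C) z w i j = z * w (transport π i) * green (hop C) z w (transport π i) j
      - ∑ σ, (C - permCoin π) (π i.1) σ * green (hop C) z w (σ, i.2) j := by
  have h := pencil_inverse_apply (hop_mem_unitary hC) hz w (basisVec j)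
  have h2 := congrArg (fun φ : Hil d => φ (transport π i)) h
  simp only [pencil_apply, lp.coeFn_sub, Pi.sub_apply, lp.coeFn_smul, Pi.smul_apply, diagOp_apply,
    basisVec_apply, if_neg hij, hop_apply_transport, smul_eq_mul] at h2
  simp only [green]
  linear_combination h2

/-- The transport equation iterated `n` times. The accumulated prefactors have modulus at most `1`,
so the errors just add up. -/
theorem enorm_green_sub_le {d : ℕ} {C : Matrix (Coin d) (Coin d) ℂ}
    (hC : C ∈ Matrix.unitaryGroup (Coin d) ℂ) {π : Equiv.Perm (Coin d)} {z : ℂ} (hz : ‖z‖ < 1)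
    (w : Label d → Disc) {j : Label d}
    {δ : ENNReal} (hδ : ∀ τ σ, ‖(C - permCoin π) τ σ‖ₑ ≤ δ) (i : Label d)
    {n : ℕ} (hn : ∀ k < n, (transport π)^[k + 1] i ≠ j) :
    ‖green (hop C) z w i j - (∏ k ∈ Finset.range n, z * w ((transport π)^[k + 1] i))
        * green (hop C) z w ((transport π)^[n] i) j‖ₑ
      ≤ ∑ k ∈ Finset.range n, ∑ σ, δ * ‖green (hop C) z w (σ, ((transport π)^[k] i).2) j‖ₑ := by
  induction n with
  | zero => simp
  | succ n ih =>
    have h := green_eq_transport hC hz w (i := (transport π)^[n] i) (π := π) (j := j)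
      (by rw [← Function.iterate_succ_apply' (transport π) n i]; exact hn n n.lt_succ_self)
    rw [← Function.iterate_succ_apply' (transport π) n i] at h
    set P := ∏ k ∈ Finset.range n, z * (w ((transport π)^[k + 1] i) : ℂ) with hP
    set β := ∑ σ, (C - permCoin π) (π ((transport π)^[n] i).1) σ
      * green (hop C) z w (σ, ((transport π)^[n] i).2) j
    have hPn : ‖P‖ₑ ≤ 1 := by
      have : ‖P‖ ≤ 1 := by
        rw [hP, norm_prod]
        refine Finset.prod_le_one (fun _ _ => norm_nonneg _) fun k _ => ?_
        rw [norm_mul]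
        exact mul_le_one₀ hz.le (norm_nonneg _) (Disc.norm_le _)
      rw [← ofReal_norm, ← ENNReal.ofReal_one]
      exact ENNReal.ofReal_le_ofReal this
    have hβ : ‖β‖ₑ ≤ ∑ σ, δ * ‖green (hop C) z w (σ, ((transport π)^[n] i).2) j‖ₑ := by
      refine (enorm_sum_le _ _).trans (Finset.sum_le_sum fun σ _ => ?_)
      rw [enorm_mul]
      gcongr
      exact hδ _ _
    rw [Finset.prod_range_succ, Finset.sum_range_succ, ← hP]
    have he : green (hop C) z w i j - P * (z * w ((transport π)^[n + 1] i))
          * green (hop C) z w ((transport π)^[n + 1] i) j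
        = (green (hop C) z w i j - P * green (hop C) z w ((transport π)^[n] i) j) + -(P * β) := by
      rw [h]; ring
    rw [he]
    refine (enorm_add_le _ _).trans (add_le_add (ih fun k hk => hn k (by omega)) ?_)
    rw [enorm_neg, enorm_mul]
    exact (mul_le_of_le_one_left' hPn).trans hβ

/-- After one full period the transported label is `i` again, which closes the equation for `G(i,j)`
up to terms of size `δ`; decoupling then removes the prefactor. -/
theorem lintegral_green_rpow_le_sum {d : ℕ} {C : Matrix (Coin d) (Coin d) ℂ}
    (hC : C ∈ Matrix.unitaryGroup (Coin d) ℂ) {π : Equiv.Perm (Coin d)} {z : ℂ} (hz : ‖z‖ < 1)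
    {j : Label d} (hπ : JumpsCancel π) {δ : ENNReal} (hδt : δ ≠ ⊤)
    (hδ : ∀ τ σ, ‖(C - permCoin π) τ σ‖ₑ ≤ δ)
    {μ : Measure Torus} [IsProbabilityMeasure μ] {s : ℝ} (hs0 : 0 < s) (hs1 : s ≤ 1) {K : NNReal}
    (hK : ∀ p q : ℂ, ‖p‖ < 1 → ‖q‖ < 1 → ∫⁻ θ, ‖1 - p * conjPhase θ‖ₑ ^ (-s) ∂μ
        ≤ K * ∫⁻ θ, ‖1 - q * conjPhase θ‖ₑ ^ s * ‖1 - p * conjPhase θ‖ₑ ^ (-s) ∂μ)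
    (i : Label d) (hij : ∀ k ≤ Function.minimalPeriod π i.1, (transport π)^[k] i ≠ j) :
    ∫⁻ ω, ‖green (hop C) z (weights ω) i j‖ₑ ^ s ∂(phaseLaw d μ)
      ≤ K * (δ ^ s * ∑ k ∈ Finset.range (Function.minimalPeriod π i.1), ∑ σ,
        ∫⁻ ω, ‖green (hop C) z (weights ω) (σ, ((transport π)^[k] i).2) j‖ₑ ^ s
          ∂(phaseLaw d μ)) := by
  have hV := hop_mem_unitary hC
  obtain ⟨m, hm⟩ : ∃ m, Function.minimalPeriod π i.1 = m + 1 :=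
    ⟨_, (Nat.succ_pred_eq_of_pos (minimalPeriod_perm_pos π i.1)).symm⟩
  -- The last label on the loop is `i` itself. Its weight is split off, and only its factor `z`
  -- stays in `q`; the other `m` labels differ from `i`.
  let q : Phases d → ℂ := fun ω =>
    (∏ k ∈ Finset.range m, z * (weights ω ((transport π)^[k + 1] i) : ℂ)) * z
  have hqm : Measurable q := by
    have : ∀ l : Label d, Measurable fun ω : Phases d => (weights ω l : ℂ) := fun l =>
      continuous_conjPhase.measurable.comp (measurable_pi_apply l)
    exact (Finset.measurable_fun_prod _ fun k _ => (this _).const_mul z).mul_const z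
  have hq1 : ∀ ω, ‖q ω‖ < 1 := by
    intro ω
    rw [norm_mul, norm_prod]
    refine lt_of_le_of_lt (mul_le_of_le_one_left (norm_nonneg _) ?_) hz
    refine Finset.prod_le_one (fun _ _ => norm_nonneg _) fun k _ => ?_
    rw [norm_mul]
    exact mul_le_one₀ hz.le (norm_nonneg _) (Disc.norm_le _)
  have hq : ∀ ω θ, q (Function.update ω i θ) = q ω := by
    intro ω θ
    refine congrArg (· * z) (Finset.prod_congr rfl fun k hk => ?_)
    rw [weights_update, Function.update_of_ne]
    exact transport_iterate_ne π i k.succ_pos (by rw [hm]; simpa using hk)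
  refine (lintegral_green_rpow_le_decoupled hV hz hs0.le hK i j hqm hq1 hq).trans ?_
  gcongr
  have hmeas : ∀ l : Label d, Measurable fun ω : Phases d =>
      ‖green (hop C) z (weights ω) l j‖ₑ ^ s :=
    fun l => (measurable_green hV hz l j).enorm.pow_const s
  have hpt : ∀ ω : Phases d, ‖(1 - q ω * weights ω i) * green (hop C) z (weights ω) i j‖ₑ ^ s
      ≤ δ ^ s * ∑ k ∈ Finset.range (m + 1), ∑ σ,
        ‖green (hop C) z (weights ω) (σ, ((transport π)^[k] i).2) j‖ₑ ^ s := by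
    intro ω
    have h := enorm_green_sub_le hC hz (weights ω) hδ i (n := m + 1) (j := j)
      (fun k hk => hij (k + 1) (by omega))
    have hp : (transport π)^[m + 1] i = i := by
      rw [← hm]; exact transport_iterate_minimalPeriod hπ i
    rw [Finset.prod_range_succ, hp] at h
    have he : (1 - q ω * weights ω i) * green (hop C) z (weights ω) i j
        = green (hop C) z (weights ω) i j
          - (∏ k ∈ Finset.range m, z * (weights ω ((transport π)^[k + 1] i) : ℂ))
            * (z * weights ω i) * green (hop C) z (weights ω) i j := by
      simp only [q]; ring
    rw [he]
    refine (ENNReal.rpow_le_rpow h hs0.le).trans ?_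
    rw [Finset.mul_sum]
    refine (rpow_sum_le_sum_rpow _ _ hs0 hs1).trans (Finset.sum_le_sum fun k _ => ?_)
    rw [Finset.mul_sum]
    refine (rpow_sum_le_sum_rpow _ _ hs0 hs1).trans (Finset.sum_le_sum fun σ _ => ?_)
    rw [ENNReal.mul_rpow_of_nonneg _ _ hs0.le]
  refine (lintegral_mono hpt).trans (le_of_eq ?_)
  rw [lintegral_const_mul' _ _ (ENNReal.rpow_ne_top_of_nonneg hs0.le hδt), hm,
    lintegral_finsetSum _ fun k _ => Finset.measurable_fun_sum _ fun σ _ => hmeas _]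
  congr 1
  refine Finset.sum_congr rfl fun k _ => ?_
  rw [lintegral_finsetSum _ fun σ _ => hmeas _]

/-! ### Exponential decay by iterating the loop estimate -/

theorem exists_lintegral_green_rpow_le_exp {d : ℕ} {μ : Measure Torus} [IsProbabilityMeasure μ]
    (hμ : HasBoundedDensity μ) {π : Equiv.Perm (Coin d)} (hπ : JumpsCancel π)
    {s : ℝ} (hs0 : 0 < s) (hs1 : s < 1) :
    ∃ δ : ℝ, 0 < δ ∧ ∃ γ : ℝ, 0 < γ ∧ ∃ B : ℝ, 0 < B ∧
      ∀ C ∈ Matrix.unitaryGroup (Coin d) ℂ, coinNorm (C - permCoin π) ≤ δ →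
      ∀ z : ℂ, ‖z‖ < 1 → ∀ i j : Label d,
        ∫⁻ ω, ‖green (hop C) z (weights ω) i j‖ₑ ^ s ∂(phaseLaw d μ)
          ≤ ENNReal.ofReal (B * Real.exp (-γ * ‖i.2 - j.2‖)) := by
  obtain ⟨K, hK1, hK⟩ := exists_lintegral_rpow_neg_le hμ hs0.le hs1
  obtain ⟨L, hL⟩ := exists_lintegral_rpow_neg_le_mul hμ hs0 hs1
  set M : ℕ := ∑ τ, Function.minimalPeriod π τ with hM
  have hMle : ∀ τ, Function.minimalPeriod π τ ≤ M := fun τ =>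
    Finset.single_le_sum (f := fun τ => Function.minimalPeriod π τ) (fun _ _ => Nat.zero_le _)
      (Finset.mem_univ τ)
  set N : ℕ := M * Fintype.card (Coin d) with hN
  -- `ε` stands for `δ ^ s`; at most `N` terms occur in the loop estimate, so its total factor `L ε
  -- N` is at most `1/2`.
  set ε : ℝ := 1 / (2 * (L * N + 1)) with hε
  have hεpos : 0 < ε := by positivity
  have hεle : L * ε * N ≤ 1 / 2 := by
    rw [hε, mul_one_div, div_mul_eq_mul_div, div_le_iff₀ (by positivity)]
    linarith
  have hKpos : (0 : ℝ) < K := by exact_mod_cast lt_of_lt_of_le one_pos hK1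
  refine ⟨ε ^ (1 / s), by positivity, Real.log 2 / (M + 1), by positivity, K * K * 2,
    by positivity, fun C hC hCδ z hz i j => ?_⟩
  set δ : ℝ := ε ^ (1 / s)
  have hδs : ENNReal.ofReal δ ^ s = ENNReal.ofReal ε := by
    rw [ENNReal.ofReal_rpow_of_nonneg (by positivity) hs0.le, ← Real.rpow_mul hεpos.le,
      one_div_mul_cancel hs0.ne', Real.rpow_one]
  have hδ : ∀ τ σ, ‖(C - permCoin π) τ σ‖ₑ ≤ ENNReal.ofReal δ := fun τ σ => by
    rw [← ofReal_norm]
    exact ENNReal.ofReal_le_ofReal ((norm_entry_le_coinNorm _ τ σ).trans hCδ)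
  -- A loop moves the site by at most `M`. Blocks of length `M + 1` leave a spare unit, which keeps
  -- the loop away from `j`.
  have main : ∀ n : ℕ, ∀ i : Label d, (n : ℝ) * (M + 1) ≤ ‖i.2 - j.2‖ →
      ∫⁻ ω, ‖green (hop C) z (weights ω) i j‖ₑ ^ s ∂(phaseLaw d μ)
        ≤ ENNReal.ofReal (K * K * (1 / 2) ^ n) := by
    intro n
    induction n with
    | zero =>
      intro i _
      refine (lintegral_green_rpow_le (hop_mem_unitary hC) hz hs0.le hK1 hK i j).trans
        (le_of_eq ?_)
      rw [pow_zero, mul_one, ENNReal.ofReal_mul hKpos.le, ENNReal.ofReal_coe_nnreal]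
    | succ n ih =>
      intro i hi
      push_cast at hi
      have hdist : ∀ k ≤ M, (n : ℝ) * (M + 1) + 1 ≤ ‖((transport π)^[k] i).2 - j.2‖ := by
        intro k hk
        have h1 := norm_transport_iterate_sub_le π k i
        have h2 : (k : ℝ) ≤ M := by exact_mod_cast hk
        have h3 := norm_sub_le_norm_sub_add_norm_sub i.2 ((transport π)^[k] i).2 j.2
        rw [norm_sub_rev i.2 ((transport π)^[k] i).2] at h3
        linarith
      refine (lintegral_green_rpow_le_sum hC hz hπ ENNReal.ofReal_ne_top hδ hs0 hs1.le hL i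
        fun k hk h => ?_).trans ?_
      · have h1 := hdist k (hk.trans (hMle _))
        rw [h, sub_self, norm_zero] at h1
        have : (0 : ℝ) ≤ (n : ℝ) * (M + 1) := by positivity
        linarith
      · calc _ ≤ (L : ENNReal) * (ENNReal.ofReal δ ^ s *
              ∑ k ∈ Finset.range (Function.minimalPeriod π i.1), ∑ _σ : Coin d,
                ENNReal.ofReal (K * K * (1 / 2) ^ n)) := by
              gcongr with k hk σ _
              refine ih _ ?_
              have := hdist k ((Finset.mem_range.1 hk).le.trans (hMle _))
              simp only
              linarith
          _ ≤ (L : ENNReal) * (ENNReal.ofReal ε * (N * ENNReal.ofReal (K * K * (1 / 2) ^ n))) := by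
              rw [hδs]
              gcongr
              simp only [Finset.sum_const, Finset.card_univ, Finset.card_range, nsmul_eq_mul]
              rw [← mul_assoc, hN]
              push_cast
              gcongr
              exact hMle _
          _ = ENNReal.ofReal (L * ε * N * (K * K * (1 / 2) ^ n)) := by
              rw [ENNReal.ofReal_mul (p := L * ε * N) (by positivity),
                ENNReal.ofReal_mul (p := L * ε) (by positivity),
                ENNReal.ofReal_mul (p := L) (by positivity), ENNReal.ofReal_coe_nnreal,
                ENNReal.ofReal_natCast]
              ring
          _ ≤ ENNReal.ofReal (K * K * (1 / 2) ^ (n + 1)) := by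
              refine ENNReal.ofReal_le_ofReal ?_
              rw [pow_succ]
              have : (0 : ℝ) ≤ K * K * (1 / 2) ^ n := by positivity
              nlinarith
  have hM0 : (0 : ℝ) < M + 1 := by positivity
  have hfl := Nat.floor_le (a := ‖i.2 - j.2‖ / (M + 1)) (by positivity)
  have hlt := Nat.lt_floor_add_one (‖i.2 - j.2‖ / ((M : ℝ) + 1))
  refine (main ⌊‖i.2 - j.2‖ / (M + 1)⌋₊ i ((le_div_iff₀ hM0).1 hfl)).trans
    (ENNReal.ofReal_le_ofReal ?_)
  set n := ⌊‖i.2 - j.2‖ / ((M : ℝ) + 1)⌋₊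
  have h1 : (1 / 2 : ℝ) ^ n = Real.exp (-Real.log 2 * n) := by
    rw [mul_comm, Real.exp_nat_mul, Real.exp_neg, Real.exp_log two_pos, one_div]
  have h2 : (2 : ℝ) = Real.exp (Real.log 2) := (Real.exp_log two_pos).symm
  -- Rounding the number of blocks down costs at most one factor `2`, the one included in `B`.
  have h3 : (1 / 2 : ℝ) ^ n ≤ 2 * Real.exp (-(Real.log 2 / (M + 1)) * ‖i.2 - j.2‖) := by
    rw [h1]
    conv_rhs => rw [h2, Real.log_exp, ← Real.exp_add]
    rw [Real.exp_le_exp]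
    have hlog := Real.log_pos one_lt_two
    have : Real.log 2 / (M + 1) * ‖i.2 - j.2‖ = Real.log 2 * (‖i.2 - j.2‖ / (M + 1)) := by ring
    rw [neg_mul, neg_mul, this]
    nlinarith
  rw [mul_assoc (K * K : ℝ)]
  gcongr

/-! ### The resolvent of the walk -/

/-- From `U - z = 𝔻 (V - z 𝔻⁻¹)`, with `𝔻⁻¹ e_j` equal to the weight at `j` times `e_j`. -/
theorem walk_sub_apply_inverse {d : ℕ} (ω : Phases d) {C : Matrix (Coin d) (Coin d) ℂ}
    (hC : C ∈ Matrix.unitaryGroup (Coin d) ℂ) {z : ℂ} (hz : ‖z‖ < 1) (j : Label d) :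
    (walk ω C - z • ContinuousLinearMap.id ℂ (Hil d))
      ((weights ω j : ℂ) • Ring.inverse (pencil (hop C) z (weights ω)) (basisVec j))
        = basisVec j := by
  have hφ : ∀ k, (AddCircle.toCircle (ω k) : ℂ) * weights ω k = 1 := fun k => by
    change (AddCircle.toCircle (ω k) : ℂ) * (AddCircle.toCircle (-ω k) : ℂ) = 1
    rw [← Circle.coe_mul, ← AddCircle.toCircle_add, add_neg_cancel, AddCircle.toCircle_zero,
      Circle.coe_one]
  have hfac : ∀ ψ : Hil d, (walk ω C - z • ContinuousLinearMap.id ℂ (Hil d)) ψ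
      = phaseOp ω (pencil (hop C) z (weights ω) ψ) := by
    intro ψ
    rw [pencil_apply, map_sub, map_smul]
    have : phaseOp ω (diagOp (weights ω) ψ) = ψ := by
      ext k
      change (AddCircle.toCircle (ω k) : ℂ) * (weights ω k * ψ k) = ψ k
      rw [← mul_assoc, hφ, one_mul]
    rw [this]
    rfl
  rw [hfac, map_smul, pencil_inverse_apply (hop_mem_unitary hC) hz]
  ext k
  change (AddCircle.toCircle (ω k) : ℂ) * ((weights ω j : ℂ) * basisVec j k) = basisVec j k
  rw [basisVec_apply]
  by_cases h : k = j
  · subst h; simpa using hφ k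
  · simp [h]

theorem res_apply_basisVec {d : ℕ} (ω : Phases d) {C : Matrix (Coin d) (Coin d) ℂ}
    (hC : C ∈ Matrix.unitaryGroup (Coin d) ℂ) {z : ℂ} (hz : ‖z‖ < 1) (j : Label d) :
    res ω C z (basisVec j)
      = (weights ω j : ℂ) • Ring.inverse (pencil (hop C) z (weights ω)) (basisVec j) := by
  have h := congrArg (res ω C z) (walk_sub_apply_inverse ω hC hz j)
  rw [← h, res, ← mul_apply_eq_comp, Ring.inverse_mul_cancel _ (isUnit_walk_sub ω hC hz.ne)]
  rfl

theorem norm_inner_res {d : ℕ} (ω : Phases d) {C : Matrix (Coin d) (Coin d) ℂ}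
    (hC : C ∈ Matrix.unitaryGroup (Coin d) ℂ) {z : ℂ} (hz : ‖z‖ < 1) (i j : Label d) :
    ‖inner ℂ (basisVec i) (res ω C z (basisVec j))‖ = ‖green (hop C) z (weights ω) i j‖ := by
  rw [res_apply_basisVec ω hC hz, inner_basisVec, lp.coeFn_smul, Pi.smul_apply, norm_smul]
  have : ‖(weights ω j : ℂ)‖ = 1 := norm_conjPhase _
  rw [this, one_mul]
  rfl

/-- Unitarity exchanges the outside and the inside of the circle. With `R` the resolvent at `1 /
z̄`, the bracket equals `U* R*`, and multiplying it by `-z⁻¹ (U - z)` gives `1`. -/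
theorem res_eq_reflection {d : ℕ} (ω : Phases d) {C : Matrix (Coin d) (Coin d) ℂ}
    (hC : C ∈ Matrix.unitaryGroup (Coin d) ℂ) {z : ℂ} (hz : 1 < ‖z‖) :
    res ω C z = (-z⁻¹) • (1 + z⁻¹ • star (res ω C (star z)⁻¹)) := by
  have hz0 : z ≠ 0 := norm_pos_iff.1 (one_pos.trans hz)
  have hU := (Unitary.mem_iff.1 (walk_mem_unitary ω hC)).2
  have hu := isUnit_walk_sub ω hC hz.ne'
  have hu' : IsUnit (walk ω C - (star z)⁻¹ • ContinuousLinearMap.id ℂ (Hil d)) := by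
    refine isUnit_walk_sub ω hC ?_
    rw [norm_inv, norm_star]
    exact (inv_lt_one_of_one_lt₀ hz).ne
  set U := walk ω C with hUdef
  set R := res ω C (star z)⁻¹ with hR
  have hid : ContinuousLinearMap.id ℂ (Hil d) = 1 := rfl
  have h1 : star U * star R = 1 + z⁻¹ • star R := by
    have : R * (U - (star z)⁻¹ • 1) = 1 := Ring.inverse_mul_cancel _ hu'
    have h2 := congrArg star this
    rw [star_mul, star_sub, star_smul, star_one, star_inv₀, star_star, sub_mul, smul_mul_assoc,
      one_mul] at h2
    rw [← h2]
    abel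
  have h3 : (U - z • 1) * ((-z⁻¹) • (1 + z⁻¹ • star R)) = 1 := by
    rw [sub_mul, smul_mul_assoc, one_mul, smul_smul, mul_neg, mul_inv_cancel₀ hz0, ← h1,
      mul_smul_comm, ← mul_assoc, hU, one_mul, h1]
    simp only [neg_smul, one_smul]
    abel
  calc res ω C z = Ring.inverse (U - z • 1) * ((U - z • 1) * ((-z⁻¹) • (1 + z⁻¹ • star R))) := by
        rw [h3, mul_one]; rfl
    _ = _ := by
        rw [← mul_assoc, ← hid, Ring.inverse_mul_cancel _ hu, hid, one_mul]

theorem norm_inner_res_reflection {d : ℕ} (ω : Phases d) {C : Matrix (Coin d) (Coin d) ℂ}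
    (hC : C ∈ Matrix.unitaryGroup (Coin d) ℂ) {z : ℂ} (hz : 1 < ‖z‖) {i j : Label d}
    (hij : i ≠ j) :
    ‖inner ℂ (basisVec i) (res ω C z (basisVec j))‖
      = ‖z‖⁻¹ * ‖z‖⁻¹ * ‖green (hop C) (star z)⁻¹ (weights ω) j i‖ := by
  have hz' : ‖(star z)⁻¹‖ < 1 := by
    rw [norm_inv, norm_star]
    exact inv_lt_one_of_one_lt₀ hz
  rw [res_eq_reflection ω hC hz, ← norm_inner_res ω hC hz' j i, _root_.smul_apply,
    _root_.add_apply, _root_.smul_apply, one_apply_eq_self, inner_smul_right, inner_add_right,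
    inner_smul_right, ContinuousLinearMap.star_eq_adjoint, ContinuousLinearMap.adjoint_inner_right,
    inner_basisVec, basisVec_apply, if_neg hij, zero_add, norm_mul, norm_mul, norm_neg, norm_inv,
    norm_inner_symm, mul_assoc]

/-- Lyapunov's inequality. It passes to smaller exponents for the same `C`, and so keeps `δ`
independent of `s`. -/
theorem lintegral_green_rpow_le_exp_of_le {d : ℕ} {μ : Measure Torus}
    [IsProbabilityMeasure μ] {C : Matrix (Coin d) (Coin d) ℂ}
    (hC : C ∈ Matrix.unitaryGroup (Coin d) ℂ) {z : ℂ} (hz : ‖z‖ < 1) {s t : ℝ} (hs : 0 < s)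
    (hst : s ≤ t) {i j : Label d} {B γ r : ℝ} (hB : 0 < B)
    (h : ∫⁻ ω, ‖green (hop C) z (weights ω) i j‖ₑ ^ t ∂(phaseLaw d μ)
          ≤ ENNReal.ofReal (B * Real.exp (-γ * r))) :
    ∫⁻ ω, ‖green (hop C) z (weights ω) i j‖ₑ ^ s ∂(phaseLaw d μ)
          ≤ ENNReal.ofReal (B ^ (s / t) * Real.exp (-(γ * (s / t)) * r)) := by
  have ht : 0 < t := hs.trans_le hst
  have : IsProbabilityMeasure (phaseLaw d μ) := by rw [phaseLaw]; infer_instance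
  have hJ := eLpNorm'_le_eLpNorm'_of_exponent_le hs hst (phaseLaw d μ)
    (measurable_green (hop_mem_unitary hC) hz i j).aestronglyMeasurable
  rw [eLpNorm', eLpNorm', one_div, ENNReal.rpow_inv_le_iff hs, ← ENNReal.rpow_mul,
    one_div_mul_eq_div] at hJ
  refine (hJ.trans (ENNReal.rpow_le_rpow h (by positivity))).trans (le_of_eq ?_)
  rw [ENNReal.ofReal_rpow_of_nonneg (by positivity) (by positivity),
    Real.mul_rpow hB.le (Real.exp_pos _).le, ← Real.exp_mul]
  ring_nf

end QWalk

theorem theorem2 (d : ℕ) (hd : 1 ≤ d)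
    (μ : Measure Torus) [IsProbabilityMeasure μ] (hμ : HasBoundedDensity μ)
    (π : Equiv.Perm (Coin d)) (hπ : JumpsCancel π) :
    ∃ δ : ℝ, 0 < δ ∧ ∀ s : ℝ, 0 < s → s < 1 / 3 →
      ∃ γ : ℝ, 0 < γ ∧ ∃ c : ℝ, 0 < c ∧
        ∀ C ∈ Matrix.unitaryGroup (Coin d) ℂ, coinNorm (C - permCoin π) ≤ δ →
        ∀ x y : Site d, 2 < ‖x - y‖ →
        ∀ τ σ : Coin d,
        ∀ z : ℂ, 1 / 2 < ‖z‖ → ‖z‖ < 2 → ‖z‖ ≠ 1 →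
          (∀ ω : Phases d, IsUnit (walk ω C - z • ContinuousLinearMap.id ℂ (Hil d))) ∧
          Integrable (fun ω : Phases d => ‖inner ℂ (ket τ x) (res ω C z (ket σ y))‖ ^ s)
            (phaseLaw d μ) ∧
          ∫ ω : Phases d, ‖inner ℂ (ket τ x) (res ω C z (ket σ y))‖ ^ s ∂(phaseLaw d μ)
            ≤ c * Real.exp (-γ * ‖x - y‖) := by
  obtain ⟨δ, hδ, γ, hγ, B, hB, h⟩ := exists_lintegral_green_rpow_le_exp hμ hπ
    (s := 1 / 3) (by norm_num) (by norm_num)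
  refine ⟨δ, hδ, fun s hs hs3 => ⟨γ * (s / (1 / 3)), by positivity, B ^ (s / (1 / 3)),
    by positivity, fun C hC hCδ x y hxy τ σ z _ _ hz1 =>
      ⟨fun ω => isUnit_walk_sub ω hC hz1, ?_⟩⟩⟩
  have hmain : ∀ ζ : ℂ, ‖ζ‖ < 1 → ∀ i j : Label d,
      Integrable (fun ω : Phases d => ‖green (hop C) ζ (weights ω) i j‖ ^ s) (phaseLaw d μ) ∧
      ∫ ω : Phases d, ‖green (hop C) ζ (weights ω) i j‖ ^ s ∂(phaseLaw d μ)
        ≤ B ^ (s / (1 / 3)) * Real.exp (-(γ * (s / (1 / 3))) * ‖i.2 - j.2‖) := by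
    intro ζ hζ i j
    have hle := lintegral_green_rpow_le_exp_of_le hC hζ hs hs3.le hB (h C hC hCδ ζ hζ i j)
    have hm : Measurable fun ω : Phases d => ‖green (hop C) ζ (weights ω) i j‖ ^ s :=
      (measurable_green (hop_mem_unitary hC) hζ i j).norm.pow_const s
    have he : ∀ ω : Phases d, ENNReal.ofReal (‖green (hop C) ζ (weights ω) i j‖ ^ s)
        = ‖green (hop C) ζ (weights ω) i j‖ₑ ^ s := fun ω => by
      rw [← ENNReal.ofReal_rpow_of_nonneg (norm_nonneg _) hs.le, ofReal_norm]
    refine ⟨⟨hm.aestronglyMeasurable, ?_⟩, ?_⟩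
    · rw [hasFiniteIntegral_iff_ofReal (Filter.Eventually.of_forall fun ω => by positivity)]
      simp only [he]
      exact hle.trans_lt ENNReal.ofReal_lt_top
    · rw [integral_eq_lintegral_of_nonneg_ae (Filter.Eventually.of_forall fun ω => by positivity)
        hm.aestronglyMeasurable]
      simp only [he]
      exact ENNReal.toReal_le_of_le_ofReal (by positivity) hle
  change Integrable (fun ω => ‖inner ℂ (basisVec (τ, x)) (res ω C z (basisVec (σ, y)))‖ ^ s) _ ∧
    ∫ ω, ‖inner ℂ (basisVec (τ, x)) (res ω C z (basisVec (σ, y)))‖ ^ s ∂_ ≤ _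
  rcases lt_or_gt_of_ne hz1 with hz | hz
  · simp only [norm_inner_res _ hC hz]
    exact hmain z hz (τ, x) (σ, y)
  -- Distinct labels remove the identity term of the reflection formula. The adjoint swaps the two
  -- labels, which leaves the distance unchanged.
  · have hne : ((τ, x) : Label d) ≠ (σ, y) := by
      intro he
      rw [(Prod.mk.inj he).2, sub_self, norm_zero] at hxy
      linarith
    have hz' : ‖(star z)⁻¹‖ < 1 := by
      rw [norm_inv, norm_star]
      exact inv_lt_one_of_one_lt₀ hz
    obtain ⟨h1, h2⟩ := hmain _ hz' (σ, y) (τ, x)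
    have hzi : 0 ≤ ‖z‖⁻¹ * ‖z‖⁻¹ := by positivity
    simp only [norm_inner_res_reflection _ hC hz hne, Real.mul_rpow hzi (norm_nonneg _)]
    refine ⟨h1.const_mul _, ?_⟩
    rw [integral_const_mul, norm_sub_rev]
    refine le_trans (mul_le_of_le_one_left (integral_nonneg fun ω => by positivity) ?_) h2
    refine Real.rpow_le_one hzi ?_ hs.le
    exact mul_le_one₀ (inv_le_one_of_one_le₀ hz.le) (by positivity) (inv_le_one_of_one_le₀ hz.le)
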